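/- Let $K$ be a field and $n\ge 1$ an integer. A \emph{form} is a homogeneous polynomial in $K[x_0,x_1,x_2]$, and $V(f)\subseteq\mathbb P^2(K)$ denotes the set of zeros of a form $f$ among the ($K$-rational) points of the projective plane. Let $\mathrm{Var}_{\le n}(K)$ be the set of all points of $\mathbb P^2(K)$ (regarded as one-element sets) and all irreducible curves of degree $\le n$, i.e. all nonempty sets $V(f)$ with $f$ an irreducible form of degree $\le n$; it is a poset under inclusion. Let $\mathrm{Var}^{\mathrm{Zar}}_{\le n}(K)$ be the poset, under inclusion, of all irreducible Zariski closed proper subsets $Z$ of $\mathbb P^2(K)$ (Zariski closed means: set of common zeros of a set of forms) which are points or have degree $\le n$, where the degree of $Z$ is the least degree of a nonzero form vanishing on $Z$. If $K$ is algebraically closed, then $\mathrm{Var}^{\mathrm{Zar}}_{\le n}(K)=\mathrm{Var}_{\le n}(K)$. Let $\mathcal V$ be either $\mathrm{Var}_{\le n}(K)$ ($K$ arbitrary), or $\mathrm{Var}^{\mathrm{Zar}}_{\le n}(K)$ provided that the cardinalities of the finite sets of the form $V(f)$, $f$ a form of degree $\le n$, are bounded. Two structures $M$, $N$ are \emph{bi-interpretable}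 (with parameters) if each is interpretable in the other (as a structure living on a definable quotient of a definable set of tuples) in such a way that the isomorphisms from the resulting copy of $M$ inside $M$ to $M$, and from the resulting copy of $N$ inside $N$ to $N$, are definable. Then: 1. The poset $\mathcal V$ (in the language $\{\le\}$) is bi-interpretable with the field $K$ (in the language of rings), using parameters. 2. If $K$ is infinite, then for any four points of $\mathbb P^2(K)$, no three of them collinear, such a bi-interpretation exists whose parameters are these four points on the side of $\mathcal V$ and which uses no parameters on the side of $K$. 3. If $K$ is infinite, then an element $Z$ of $\mathcal V$ is a projective line if and only if it has more than $n$ points and meets every other element of $\mathcal V$ in at most $n$ points; and the set of lines is definable without parameters in $\mathcal V$. -/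

import Mathlib

universe u v u' v' w w'

namespace CurvePoset

/-! ### Interpretations and bi-interpretations -/

/-- An interpretation, with parameters from `A ⊆ M`, of the `L'`-structure `N` in the
`L`-structure `M`. The set `dom ⊆ M ^ dim` is definable, `map` restricted to `dom` is a surjection
onto `N` (values of `map` outside `dom` play no role), and the equivalence relation
`map x = map y` on `dom`, the graphs of the function symbols of `L'` and the relation symbols of
`L'`, all pulled back to `dom`, are definable in `M` over `A`. In other words `map` induces an
isomorphism onto `N` of a structure which lives on the definable quotient
`dom / (map x = map y)` and which is definable in `M` with imaginaries. -/
structure Interpretation (L : FirstOrder.Language.{u, v}) (M : Type w) [L.Structure M] (A : Set M)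
    (L' : FirstOrder.Language.{u', v'}) (N : Type w') [L'.Structure N] where
  dim : ℕ
  dom : Set (Fin dim → M)
  map : (Fin dim → M) → N
  surj : Set.SurjOn map dom Set.univ
  definable_dom : A.Definable L dom
  definable_eq : A.Definable L
    {x : Fin 2 × Fin dim → M |
      (∀ i, (fun j => x (i, j)) ∈ dom) ∧
        map (fun j => x (0, j)) = map (fun j => x (1, j))}
  definable_fun : ∀ (k : ℕ) (g : L'.Functions k), A.Definable L
    {x : Fin (k + 1) × Fin dim → M |
      (∀ i, (fun j => x (i, j)) ∈ dom) ∧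
        FirstOrder.Language.Structure.funMap g (fun i : Fin k => map (fun j => x (i.castSucc, j))) =
          map (fun j => x (Fin.last k, j))}
  definable_rel : ∀ (k : ℕ) (r : L'.Relations k), A.Definable L
    {x : Fin k × Fin dim → M |
      (∀ i, (fun j => x (i, j)) ∈ dom) ∧
        FirstOrder.Language.Structure.RelMap r (fun i : Fin k => map (fun j => x (i, j)))}

/-- Given an interpretation `I` of `N` in `M` and an interpretation `J` of `M` in `N`, the
composite interprets `M` in itself: a tuple of tuples from `M` is sent by `I` to a tuple from `N`,
and then by `J` to an element of `M`. This is the graph of that map, i.e. of the isomorphism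
between the copy of `M` defined inside `M` and `M` itself. -/
def compositeGraph {L : FirstOrder.Language.{u, v}} {M : Type w} [L.Structure M] {A : Set M}
    {L' : FirstOrder.Language.{u', v'}} {N : Type w'} [L'.Structure N] {B : Set N}
    (I : Interpretation L M A L' N) (J : Interpretation L' N B L M) :
    Set ((Fin J.dim × Fin I.dim) ⊕ Unit → M) :=
  {x | (∀ i, (fun j => x (Sum.inl (i, j))) ∈ I.dom) ∧
    (fun i => I.map (fun j => x (Sum.inl (i, j)))) ∈ J.dom ∧
    J.map (fun i => I.map (fun j => x (Sum.inl (i, j)))) = x (Sum.inr ())}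

/-- `M` and `N` are bi-interpretable, with parameters from `A ⊆ M` and `B ⊆ N`: each is
interpretable in the other, and the isomorphisms of `M` and of `N` with their copies under the
two composite self-interpretations are definable (over `A` in `M` and over `B` in `N`). -/
def BiInterpretable (L : FirstOrder.Language.{u, v}) (M : Type w) [L.Structure M] (A : Set M)
    (L' : FirstOrder.Language.{u', v'}) (N : Type w') [L'.Structure N] (B : Set N) : Prop :=
  ∃ (I : Interpretation L M A L' N) (J : Interpretation L' N B L M),
    A.Definable L (compositeGraph I J) ∧ B.Definable L' (compositeGraph J I)

/-! ### Points and curves in the projective plane -/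

/-- The projective plane `ℙ²(K)`, the set of lines through the origin of `K³`. -/
abbrev Plane (K : Type u) [Field K] : Type u := Projectivization K (Fin 3 → K)

/-- The set of zeros in `ℙ²(K)` of a polynomial `f` (used for homogeneous `f` only, where it does
not matter which homogeneous coordinates are used, see `mk_mem_zeroSet`). -/
def zeroSet {K : Type u} [Field K] (f : MvPolynomial (Fin 3) K) : Set (Plane K) :=
  {P | MvPolynomial.eval P.rep f = 0}

theorem mk_mem_zeroSet {K : Type u} [Field K] {f : MvPolynomial (Fin 3) K} {d : ℕ}
    (hf : f.IsHomogeneous d) (x : Fin 3 → K) (hx : x ≠ 0) :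
    Projectivization.mk K x hx ∈ zeroSet f ↔ MvPolynomial.eval x f = 0 := by
  obtain ⟨a, ha⟩ := Projectivization.exists_smul_eq_mk_rep K x hx
  have h : MvPolynomial.eval (a • x) f = (a : K) ^ d * MvPolynomial.eval x f := by
    rw [MvPolynomial.eval_eq, MvPolynomial.eval_eq, Finset.mul_sum]
    refine Finset.sum_congr rfl fun m hm => ?_
    have hd : ∑ i, m i = d := by
      have := hf (MvPolynomial.mem_support_iff.mp hm)
      rw [Finsupp.weight_apply, Finsupp.sum_fintype _ _ (by simp)] at this
      simpa using this
    simp only [Pi.smul_apply, Units.smul_def, smul_eq_mul, mul_pow, Finset.prod_mul_distrib]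
    rw [Finset.prod_pow_eq_pow_sum, Finset.prod_subset (Finset.subset_univ m.support)
      (fun i _ hi => by simp [Finsupp.notMem_support_iff.mp hi]), Finset.sum_subset (Finset.subset_univ m.support)
      (fun i _ hi => by simpa using hi), hd]
    ring
  simp only [zeroSet, Set.mem_ofPred_eq, ← ha]
  simp [h]

/-- A projective line. -/
def IsLine {K : Type u} [Field K] (Z : Set (Plane K)) : Prop :=
  ∃ f : MvPolynomial (Fin 3) K, f.IsHomogeneous 1 ∧ f ≠ 0 ∧ Z = zeroSet f

/-- The points of `ℙ²(K)` (as singletons) and the irreducible plane curves of degree at most `n`,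
i.e. the nonempty zero sets of irreducible forms of degree at most `n`. As a type this is a poset,
ordered by inclusion of sets. -/
def Var (K : Type u) [Field K] (n : ℕ) : Set (Set (Plane K)) :=
  {Z | (∃ P, Z = {P}) ∨
    (Z.Nonempty ∧ ∃ f : MvPolynomial (Fin 3) K, ∃ d ≤ n,
      f.IsHomogeneous d ∧ Irreducible f ∧ Z = zeroSet f)}

/-- A subset of `ℙ²(K)` is Zariski closed if it is the set of common zeros of a set of forms. -/
def IsZariskiClosed {K : Type u} [Field K] (Z : Set (Plane K)) : Prop :=
  ∃ S : Set (MvPolynomial (Fin 3) K), (∀ f ∈ S, ∃ d, f.IsHomogeneous d) ∧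
    Z = {P | ∀ f ∈ S, P ∈ zeroSet f}

/-- Irreducible Zariski closed subsets of `ℙ²(K)`. -/
def IsIrreducibleClosed {K : Type u} [Field K] (Z : Set (Plane K)) : Prop :=
  IsZariskiClosed Z ∧ Z.Nonempty ∧
    ∀ X Y : Set (Plane K), IsZariskiClosed X → IsZariskiClosed Y → Z ⊆ X ∪ Y → Z ⊆ X ∨ Z ⊆ Y

/-- The irreducible Zariski closed proper subsets of `ℙ²(K)` which are points or have degree at
most `n`; here the degree of `Z` is the least degree of a nonzero form vanishing on `Z`
(if `Z` is not a point, the forms vanishing on `Z` are the multiples of one of them). -/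
def ZariskiVar (K : Type u) [Field K] (n : ℕ) : Set (Set (Plane K)) :=
  {Z | IsIrreducibleClosed Z ∧ Z ≠ Set.univ ∧
    ((∃ P, Z = {P}) ∨ ∃ f : MvPolynomial (Fin 3) K, ∃ d ≤ n,
      f.IsHomogeneous d ∧ f ≠ 0 ∧ Z ⊆ zeroSet f)}

/-- The finite zero sets of forms of degree at most `n` have bounded cardinality. -/
def BoundedFiniteZeroSets (K : Type u) [Field K] (n : ℕ) : Prop :=
  ∃ N : ℕ, ∀ (f : MvPolynomial (Fin 3) K), ∀ d ≤ n, f.IsHomogeneous d →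
    (zeroSet f).Finite → (zeroSet f).ncard ≤ N

/-- Four points, no three of which are collinear. -/
def IsFrame {K : Type u} [Field K] (p : Fin 4 → Plane K) : Prop :=
  ∀ s : Fin 3 → Fin 4, Function.Injective s → Projectivization.Independent (p ∘ s)

/-- A family of subsets of `ℙ²(K)`, ordered by inclusion, as a structure in the language of
posets. -/
instance posetStructure {K : Type u} [Field K] (V : Set (Set (Plane K))) :
    FirstOrder.Language.order.Structure V :=
  FirstOrder.Language.orderStructure V

end CurvePoset

/-!
If `K` is finite, then both structures are finite, every relation on them is definable from their
elements, and there is nothing to do. So let `K` be infinite.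

*Reduction to one kind of family.* Two forms, one of them irreducible and not dividing the other, have
finitely many common zeros in the plane (`finite_zeroSet_inter`, by elimination of a variable). Hence the
irreducible Zariski closed proper subsets are the points and the infinite zero sets of irreducible forms
(`mem_zariskiVar_iff`), and both posets in question are of the form `curveFamily K n m`: points, together
with zero sets of irreducible forms of degree at most `n` having at least `m` points. Over an algebraically
closed field the zero set of an irreducible form is infinite, and the two posets are equal.

*Lines.* A line meets another irreducible curve of degree at most `n` in at most `n` points, because the
restriction of a form to the line is a polynomial in one variable. Conversely, through any `n + 1` points of
a curve that is not a line passes another curve of the family, in suitable coordinates the graph of an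
interpolation polynomial (`exists_curve_through`); this is irreducible and has infinitely many points
over any infinite field. So `isLine_iff_encard_inter_le` describes the lines by conditions which are first
order in the poset, the points being its minimal elements.

*The field inside the poset.* Once points and lines are definable, a frame of four points introduces
coordinates. The field is interpreted on the diagonal `{(a, a)}`, with addition and multiplication given by
collinearity (`addRel_iff`, `mulRel_iff`). By induction on formulas every definable relation on the field
becomes definable on the diagonal (`definable_image_of_definable`).

*The poset inside the field.* A point is coded by a coordinate vector, and a curve by the coefficients of
its equation, in the coordinates of the frame. Irreducibility is first order in the coefficients, since it
is a statement about factors of bounded degree, and so is the incidence of points and curves.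

*Composites.* An element of the poset is determined by the points incident with it. The code of a
curve, written on the diagonal, defines the curve as the element containing exactly the points whose
homogeneous coordinates satisfy the equation, and a scalar `a` is recovered from any code of the point
`(1 : a : a)`. This is `biInterpretable_of_coding`.
-/

namespace CurvePoset

section

open MvPolynomial

variable {K : Type*} [Field K]

/-! ### Points and zero sets -/

/-- The point of the plane with homogeneous coordinates `x`. The zero vector, which represents no
point, is sent to `(1 : 1 : 1)`; this makes `pt` a total function. -/
noncomputable def pt (x : Fin 3 → K) : Plane K := by
  classical
  exact if h : x ≠ 0 then Projectivization.mk K x h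
    else Projectivization.mk K (fun _ => 1) (fun h => one_ne_zero (congrFun h 0))

theorem pt_of_ne {x : Fin 3 → K} (h : x ≠ 0) : pt x = Projectivization.mk K x h := dif_pos h

theorem pt_rep (P : Plane K) : pt P.rep = P := by
  rw [pt_of_ne P.rep_nonzero, Projectivization.mk_rep]

theorem exists_pt (P : Plane K) : ∃ x : Fin 3 → K, x ≠ 0 ∧ pt x = P :=
  ⟨P.rep, P.rep_nonzero, pt_rep P⟩

theorem pt_eq_pt {x y : Fin 3 → K} (hx : x ≠ 0) (hy : y ≠ 0) :
    pt x = pt y ↔ ∃ c : K, c • y = x := by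
  rw [pt_of_ne hx, pt_of_ne hy, Projectivization.mk_eq_mk_iff']

theorem pt_smul {x : Fin 3 → K} {c : K} (hc : c ≠ 0) (hx : x ≠ 0) : pt (c • x) = pt x :=
  (pt_eq_pt (smul_ne_zero hc hx) hx).2 ⟨c, rfl⟩

theorem pt_mem_zeroSet {f : MvPolynomial (Fin 3) K} {d : ℕ} (hf : f.IsHomogeneous d)
    {x : Fin 3 → K} (hx : x ≠ 0) : pt x ∈ zeroSet f ↔ eval x f = 0 := by
  rw [pt_of_ne hx, mk_mem_zeroSet hf]

theorem zeroSet_mul (f g : MvPolynomial (Fin 3) K) : zeroSet (f * g) = zeroSet f ∪ zeroSet g := by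
  ext P; simp [zeroSet]

theorem zeroSet_subset_of_dvd {f g : MvPolynomial (Fin 3) K} (h : f ∣ g) :
    zeroSet f ⊆ zeroSet g := by
  obtain ⟨k, rfl⟩ := h
  rw [zeroSet_mul]; exact Set.subset_union_left

theorem zeroSet_eq_of_associated {f g : MvPolynomial (Fin 3) K} (h : Associated f g) :
    zeroSet f = zeroSet g :=
  (zeroSet_subset_of_dvd h.dvd).antisymm (zeroSet_subset_of_dvd h.symm.dvd)

theorem le_encard_iff_exists_injective {α : Type*} {S : Set α} {m : ℕ} :
    (m : ℕ∞) ≤ S.encard ↔ ∃ P : Fin m → α, Function.Injective P ∧ ∀ i, P i ∈ S := by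
  constructor
  · intro h
    obtain ⟨S', hS', hcard⟩ := Set.exists_subset_encard_eq h
    have hfin : S'.Finite := Set.finite_of_encard_eq_coe hcard
    have hn : Nat.card S' = m := by
      rw [Nat.card_coe_set_eq, Set.ncard, hcard]; rfl
    have : Finite S' := hfin
    let e := (Finite.equivFinOfCardEq hn).symm
    exact ⟨fun i => e i, Subtype.val_injective.comp e.injective, fun i => hS' (e i).2⟩
  · rintro ⟨P, hP, hS⟩
    have := hP.encard_range
    rw [ENat.card_eq_coe_fintype_card, Fintype.card_fin] at this
    refine this.trans ?_
    exact Set.encard_le_encard (Set.range_subset_iff.2 hS)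

/-! ### Linear forms -/

/-- The linear form with coefficient vector `a`. -/
noncomputable def linForm (a : Fin 3 → K) : MvPolynomial (Fin 3) K := ∑ i, C (a i) * X i

@[simp] theorem eval_linForm (a x : Fin 3 → K) : eval x (linForm a) = a ⬝ᵥ x := by
  simp [linForm, dotProduct]

theorem linForm_isHomogeneous (a : Fin 3 → K) : (linForm a).IsHomogeneous 1 :=
  IsHomogeneous.sum _ _ _ fun _ _ => isHomogeneous_C_mul_X _ _

theorem linForm_ne_zero {a : Fin 3 → K} (ha : a ≠ 0) : linForm a ≠ 0 := by
  intro h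
  apply ha
  ext i
  have := eval_linForm a (Pi.single i 1)
  rw [h] at this
  simpa using this.symm

theorem exists_linForm {f : MvPolynomial (Fin 3) K} (hf : f.IsHomogeneous 1) :
    ∃ a, f = linForm a := by
  rw [← mem_homogeneousSubmodule, homogeneousSubmodule_one_eq_span_X] at hf
  induction hf using Submodule.span_induction with
  | mem x hx =>
    obtain ⟨i, rfl⟩ := hx
    exact ⟨Pi.single i 1, by simp [linForm, Pi.single_apply, ite_mul, Finset.sum_ite_eq', apply_ite C]⟩
  | zero => exact ⟨0, by simp [linForm]⟩
  | add x y _ _ hx hy =>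
    obtain ⟨a, rfl⟩ := hx
    obtain ⟨b, rfl⟩ := hy
    exact ⟨a + b, by simp [linForm, add_mul, Finset.sum_add_distrib]⟩
  | smul c x _ hx =>
    obtain ⟨a, rfl⟩ := hx
    exact ⟨c • a, by simp [linForm, Finset.mul_sum, mul_assoc, smul_eq_C_mul]⟩

theorem isLine_iff {Z : Set (Plane K)} : IsLine Z ↔ ∃ a, a ≠ 0 ∧ Z = zeroSet (linForm a) := by
  constructor
  · rintro ⟨f, hf, h0, rfl⟩
    obtain ⟨a, rfl⟩ := exists_linForm hf
    exact ⟨a, by rintro rfl; exact h0 (by simp [linForm]), rfl⟩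
  · rintro ⟨a, ha, rfl⟩
    exact ⟨_, linForm_isHomogeneous a, linForm_ne_zero ha, rfl⟩

theorem irreducible_of_isHomogeneous_one {f : MvPolynomial (Fin 3) K} (hf : f.IsHomogeneous 1)
    (h0 : f ≠ 0) : Irreducible f := by
  have hd := hf.totalDegree h0
  refine ⟨fun hu => ?_, fun a b hab => ?_⟩
  · have := (isUnit_iff_totalDegree_of_isReduced.1 hu).2
    omega
  · subst hab
    have ha : a ≠ 0 := left_ne_zero_of_mul h0
    have hb : b ≠ 0 := right_ne_zero_of_mul h0
    rw [totalDegree_mul_of_isDomain ha hb] at hd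
    have key : ∀ c : MvPolynomial (Fin 3) K, c ≠ 0 → c.totalDegree = 0 → IsUnit c := by
      intro c hc h
      rw [totalDegree_eq_zero_iff_eq_C] at h
      rw [h] at hc ⊢
      exact (isUnit_iff_ne_zero.2 (fun h' => hc (by rw [h', map_zero]))).map C
    rcases Nat.eq_zero_or_pos a.totalDegree with h | h
    · exact Or.inl (key a ha h)
    · exact Or.inr (key b hb (by omega))

theorem map_eq_sum_single {M : Type*} [AddCommGroup M] [Module K M] (φ : (Fin 3 → K) →ₗ[K] M)
    (x : Fin 3 → K) : φ x = ∑ i, x i • φ (Pi.single i 1) := by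
  conv_lhs => rw [pi_eq_sum_univ' x, map_sum]
  refine Finset.sum_congr rfl fun i _ => ?_
  rw [map_smul]

theorem exists_linForm_separating {P Q : Plane K} (h : P ≠ Q) :
    ∃ a : Fin 3 → K, P ∈ zeroSet (linForm a) ∧ Q ∉ zeroSet (linForm a) := by
  have hq : Q.rep ∉ Submodule.span K {P.rep} := by
    intro hmem
    obtain ⟨c, hc⟩ := Submodule.mem_span_singleton.1 hmem
    apply h
    rw [← pt_rep P, ← pt_rep Q]
    exact ((pt_eq_pt Q.rep_nonzero P.rep_nonzero).2 ⟨c, hc⟩).symm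
  obtain ⟨φ, hφ, hφ'⟩ := Submodule.exists_le_ker_of_notMem hq
  have key : ∀ x, (fun i => φ (Pi.single i 1)) ⬝ᵥ x = φ x := by
    intro x
    simp [map_eq_sum_single φ x, dotProduct, mul_comm]
  refine ⟨fun i => φ (Pi.single i 1), ?_, ?_⟩
  · simp only [zeroSet, Set.mem_ofPred_eq, eval_linForm, key]
    exact hφ' (Submodule.mem_span_singleton_self _)
  · simpa only [zeroSet, Set.mem_ofPred_eq, eval_linForm, key] using hφ

/-! ### Linear changes of coordinates -/

/-- The substitution `f ↦ f ∘ T` of linear forms for the variables. -/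
noncomputable def linSub (T : (Fin 3 → K) →ₗ[K] (Fin 3 → K)) :
    MvPolynomial (Fin 3) K →ₐ[K] MvPolynomial (Fin 3) K :=
  aeval fun i => linForm fun j => T (Pi.single j 1) i

@[simp] theorem eval_linSub (T : (Fin 3 → K) →ₗ[K] (Fin 3 → K)) (f : MvPolynomial (Fin 3) K)
    (x : Fin 3 → K) : eval x (linSub T f) = eval (T x) f := by
  have : ∀ i, eval x (linForm fun j => T (Pi.single j 1) i) = T x i := by
    intro i
    rw [eval_linForm]
    simp [map_eq_sum_single T x, dotProduct, mul_comm]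
  rw [linSub, ← coe_aeval_eq_eval, ← coe_aeval_eq_eval]
  change (aeval x) ((aeval _) f) = aeval (T x) f
  rw [aeval_eq_bind₁, aeval_bind₁]
  congr 2
  ext i
  rw [← this i, ← coe_aeval_eq_eval]; rfl

theorem linSub_isHomogeneous (T : (Fin 3 → K) →ₗ[K] (Fin 3 → K)) {f : MvPolynomial (Fin 3) K}
    {d : ℕ} (hf : f.IsHomogeneous d) : (linSub T f).IsHomogeneous d := by
  have := hf.aeval (fun i => linForm fun j => T (Pi.single j 1) i) fun i => linForm_isHomogeneous _
  rwa [one_mul] at this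

/-- Substitution along a linear automorphism, as an automorphism of the polynomial ring. -/
noncomputable def linSubEquiv [Infinite K] (T : (Fin 3 → K) ≃ₗ[K] (Fin 3 → K)) :
    MvPolynomial (Fin 3) K ≃ₐ[K] MvPolynomial (Fin 3) K :=
  AlgEquiv.ofAlgHom (linSub T.toLinearMap) (linSub T.symm.toLinearMap)
    (by
      refine AlgHom.ext fun f => MvPolynomial.funext fun x => ?_
      simp)
    (by
      refine AlgHom.ext fun f => MvPolynomial.funext fun x => ?_
      simp)

/-- Irreducibility over an infinite field does not depend on the coordinates. -/
theorem irreducible_linSub [Infinite K] (T : (Fin 3 → K) ≃ₗ[K] (Fin 3 → K))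
    {f : MvPolynomial (Fin 3) K} (hf : Irreducible f) : Irreducible (linSub T.toLinearMap f) :=
  (MulEquiv.irreducible_iff (linSubEquiv T)).2 hf

theorem pt_map_mem_zeroSet (T : (Fin 3 → K) ≃ₗ[K] (Fin 3 → K))
    {f : MvPolynomial (Fin 3) K} {d : ℕ} (hf : f.IsHomogeneous d) {x : Fin 3 → K} (hx : x ≠ 0) :
    pt (T x) ∈ zeroSet (linSub T.symm.toLinearMap f) ↔ eval x f = 0 := by
  rw [pt_mem_zeroSet (linSub_isHomogeneous _ hf) (by simpa using hx)]
  simp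

/-! ### Common zeros of two forms -/

/-- Over a factorial domain, an irreducible polynomial and a polynomial it does not divide generate an
ideal which contains a nonzero constant: by Gauss's lemma they are coprime over the fraction field, and
the denominators of a Bézout relation can be cleared. -/
theorem exists_mul_add_mul_eq_C {R : Type*} [CommRing R] [IsDomain R]
    [UniqueFactorizationMonoid R] {p q : Polynomial R} (hp : Irreducible p) (hpq : ¬ p ∣ q) :
    ∃ r : R, r ≠ 0 ∧ ∃ a b, a * p + b * q = Polynomial.C r := by
  by_cases hd : p.natDegree = 0
  · refine ⟨p.coeff 0, fun h => hp.ne_zero ?_, 1, 0, ?_⟩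
    · rw [Polynomial.eq_C_of_natDegree_eq_zero hd, h, map_zero]
    · rw [one_mul, zero_mul, add_zero, ← Polynomial.eq_C_of_natDegree_eq_zero hd]
  have hprim : p.IsPrimitive := hp.isPrimitive hd
  set F := FractionRing R
  have hirr := (hprim.irreducible_iff_irreducible_map_fraction_map (K := F)).1 hp
  have hnd : ¬ p.map (algebraMap R F) ∣ q.map (algebraMap R F) := fun h =>
    hpq (hprim.dvd_of_fraction_map_dvd_fraction_map h)
  obtain ⟨a, b, hab⟩ := (hirr.coprime_iff_not_dvd.2 hnd : IsCoprime _ _)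
  obtain ⟨s, hs, hs'⟩ := IsLocalization.integerNormalization_spec (nonZeroDivisors R) a
  obtain ⟨t, ht, ht'⟩ := IsLocalization.integerNormalization_spec (nonZeroDivisors R) b
  refine ⟨s * t, mul_ne_zero (nonZeroDivisors.ne_zero hs) (nonZeroDivisors.ne_zero ht),
    Polynomial.C t * IsLocalization.integerNormalization (nonZeroDivisors R) a,
    Polynomial.C s * IsLocalization.integerNormalization (nonZeroDivisors R) b, ?_⟩
  apply Polynomial.map_injective (algebraMap R F) (IsFractionRing.injective R F)
  simp only [Polynomial.map_add, Polynomial.map_mul, hs', ht', Polynomial.map_C, map_mul]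
  rw [Algebra.smul_def, Algebra.smul_def, Polynomial.algebraMap_apply, Polynomial.algebraMap_apply]
  linear_combination (Polynomial.C (algebraMap R F s) * Polynomial.C (algebraMap R F t)) * hab

/-- Elimination of the variable `x₀` from two equations. -/
theorem exists_eliminant_zero {f h : MvPolynomial (Fin 3) K} (hf : Irreducible f) (hfh : ¬ f ∣ h) :
    ∃ r : MvPolynomial (Fin 2) K, r ≠ 0 ∧ ∀ x : Fin 3 → K, eval x f = 0 → eval x h = 0 →
      eval (fun j => x j.succ) r = 0 := by
  classical
  let e := finSuccEquiv K 2
  obtain ⟨r, hr, a, b, hab⟩ := exists_mul_add_mul_eq_C (p := e f) (q := e h)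
    ((MulEquiv.irreducible_iff e).2 hf) (fun hd => hfh ((map_dvd_iff e).1 hd))
  refine ⟨r, hr, fun x hx hx' => ?_⟩
  have h1 := congrArg (eval x) (congrArg e.symm hab)
  have h2 : e.symm (Polynomial.C r) = rename Fin.succ r := by
    rw [AlgEquiv.symm_apply_eq]
    have : (Polynomial.CAlgHom : MvPolynomial (Fin 2) K →ₐ[MvPolynomial (Fin 2) K] _).restrictScalars K
        = (e : _ →ₐ[K] _).comp (rename Fin.succ) := by
      ext k : 1
      simp [e, finSuccEquiv_X_succ]
    exact DFunLike.congr_fun this r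
  rw [h2, map_add, map_mul, map_mul, e.symm_apply_apply, e.symm_apply_apply, eval_rename, map_add, map_mul, map_mul,
    hx, hx'] at h1
  simpa [Function.comp_def] using h1.symm

/-- The common zeros of `f` and `h` satisfy an equation in any two of the three variables. -/
theorem exists_eliminant {f h : MvPolynomial (Fin 3) K} (hf : Irreducible f) (hfh : ¬ f ∣ h)
    {i j : Fin 3} (hij : i ≠ j) :
    ∃ r : MvPolynomial (Fin 2) K, r ≠ 0 ∧ ∀ x : Fin 3 → K, eval x f = 0 → eval x h = 0 →
      eval ![x i, x j] r = 0 := by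
  obtain ⟨σ, h1, h2⟩ : ∃ σ : Equiv.Perm (Fin 3), σ 1 = i ∧ σ 2 = j := by
    clear hf hfh f h
    revert i j; decide
  let e := renameEquiv K σ.symm
  obtain ⟨r, hr, H⟩ := exists_eliminant_zero (f := e f) (h := e h)
    ((MulEquiv.irreducible_iff e).2 hf) (fun hd => hfh ((map_dvd_iff e).1 hd))
  refine ⟨r, hr, fun x hx hx' => ?_⟩
  have key : ∀ g, eval (x ∘ σ) (e g) = eval x g := by
    intro g
    simp [e, renameEquiv_apply, eval_rename, Function.comp_assoc]
  have := H (x ∘ σ) (by rw [key, hx]) (by rw [key, hx'])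
  have hv : (![x i, x j] : Fin 2 → K) = fun j => (x ∘ σ) j.succ := by
    ext k
    fin_cases k
    exacts [congrArg x h1.symm, congrArg x h2.symm]
  rwa [hv]

/-- The slopes of the lines through the origin on which a nonzero `r` vanishes are roots of a nonzero
polynomial in one variable. -/
theorem finite_setOf_forall_eval_eq_zero [Infinite K] {r : MvPolynomial (Fin 2) K} (hr : r ≠ 0) :
    {t : K | ∀ c : K, c ≠ 0 → eval ![c, c * t] r = 0}.Finite := by
  obtain ⟨v, hv⟩ : ∃ v : Fin 2 → K, eval v (r * X 0) ≠ 0 := by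
    by_contra! H
    exact mul_ne_zero hr (X_ne_zero 0) (MvPolynomial.funext fun x => by simpa using H x)
  rw [map_mul, eval_X, mul_ne_zero_iff] at hv
  let p : Polynomial K := aeval ![Polynomial.C (v 0), Polynomial.C (v 0) * Polynomial.X] r
  have hp : ∀ t, p.eval t = eval ![v 0, v 0 * t] r := by
    intro t
    rw [← Polynomial.coe_aeval_eq_eval, ← coe_aeval_eq_eval]
    change (Polynomial.aeval t) ((aeval _) r) = aeval _ r
    rw [← AlgHom.restrictScalars_apply K, ← AlgHom.comp_apply, comp_aeval]
    congr 2
    ext k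
    fin_cases k <;> simp
  have hp0 : p ≠ 0 := by
    intro h0
    apply hv.1
    have := hp (v 1 / v 0)
    rw [h0, Polynomial.eval_zero, mul_div_cancel₀ _ hv.2] at this
    rw [this]
    congr 2
    ext k
    fin_cases k <;> rfl
  refine (Polynomial.finite_setOfPred_isRoot hp0).subset fun t ht => ?_
  simp only [Set.mem_ofPred_eq, Polynomial.IsRoot, hp] at ht ⊢
  exact ht _ hv.2

/-- The part of Bézout's theorem that matters here. Each ratio of two coordinates takes finitely many
values on the common zeros, because these satisfy an equation in the two coordinates alone. -/
theorem finite_zeroSet_inter [Infinite K] {f h : MvPolynomial (Fin 3) K} {d e : ℕ}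
    (hfd : f.IsHomogeneous d) (hhe : h.IsHomogeneous e) (hf : Irreducible f) (hfh : ¬ f ∣ h) :
    (zeroSet f ∩ zeroSet h).Finite := by
  have ratio : ∀ i j : Fin 3, i ≠ j →
      ∃ A : Set K, A.Finite ∧ ∀ x : Fin 3 → K, x ≠ 0 → pt x ∈ zeroSet f ∩ zeroSet h →
        x i ≠ 0 → x j / x i ∈ A := by
    intro i j hij
    obtain ⟨r, hr, H⟩ := exists_eliminant hf hfh hij
    refine ⟨_, finite_setOf_forall_eval_eq_zero hr, fun x hx0 hx hi c hc => ?_⟩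
    rw [Set.mem_inter_iff, pt_mem_zeroSet hfd hx0, pt_mem_zeroSet hhe hx0] at hx
    have hcx : (c / x i) • x ≠ 0 := smul_ne_zero (div_ne_zero hc hi) hx0
    have := H ((c / x i) • x) ?_ ?_
    · have hv : (![c, c * (x j / x i)] : Fin 2 → K) = ![((c / x i) • x) i, ((c / x i) • x) j] := by
        ext k
        fin_cases k <;> simp <;> field_simp
      rwa [hv]
    · rw [← pt_mem_zeroSet hfd hcx, pt_smul (div_ne_zero hc hi) hx0, pt_mem_zeroSet hfd hx0]
      exact hx.1
    · rw [← pt_mem_zeroSet hhe hcx, pt_smul (div_ne_zero hc hi) hx0, pt_mem_zeroSet hhe hx0]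
      exact hx.2
  obtain ⟨A, hA, HA⟩ := ratio 0 1 (by decide)
  obtain ⟨B, hB, HB⟩ := ratio 0 2 (by decide)
  obtain ⟨D, hD, HD⟩ := ratio 1 2 (by decide)
  refine (((hA.image2 (fun s t => pt ![1, s, t]) hB).union (hD.image fun t => pt ![0, 1, t])).union
    (Set.finite_singleton (pt ![0, 0, 1]))).subset fun P hP => ?_
  obtain ⟨x, hx, rfl⟩ := exists_pt P
  by_cases h0 : x 0 = 0
  · by_cases h1 : x 1 = 0
    · right
      have h2 : x 2 ≠ 0 := fun h2 => hx (by ext i; fin_cases i <;> assumption)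
      refine (pt_eq_pt hx (by simp)).2 ⟨x 2, ?_⟩
      ext i; fin_cases i <;> simp [h0, h1]
    · left; right
      refine ⟨x 2 / x 1, HD x hx hP h1, ((pt_eq_pt hx (by simp)).2 ⟨x 1, ?_⟩).symm⟩
      ext i; fin_cases i <;> simp [h0]; field_simp
  · left; left
    refine ⟨x 1 / x 0, HA x hx hP h0, x 2 / x 0, HB x hx hP h0,
      ((pt_eq_pt hx (by simp)).2 ⟨x 0, ?_⟩).symm⟩
    ext i; fin_cases i <;> simp <;> field_simp

/-! ### Lines and curves -/

theorem exists_dotProduct_iff_exists_combination (x y z : Fin 3 → K) :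
    (∃ a : Fin 3 → K, a ≠ 0 ∧ a ⬝ᵥ x = 0 ∧ a ⬝ᵥ y = 0 ∧ a ⬝ᵥ z = 0) ↔
      (Matrix.of ![x, y, z]).det = 0 := by
  rw [← Matrix.exists_mulVec_eq_zero_iff]
  refine exists_congr fun a => and_congr_right fun _ => ?_
  rw [funext_iff, Fin.forall_fin_succ, Fin.forall_fin_succ, Fin.forall_fin_succ]
  simp [Matrix.mulVec, dotProduct_comm]

theorem mem_span_pair_of_dotProduct {a u v x : Fin 3 → K} (ha : a ≠ 0) (hu : u ≠ 0) (hv : v ≠ 0)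
    (huv : pt u ≠ pt v) (hau : a ⬝ᵥ u = 0) (hav : a ⬝ᵥ v = 0) (hax : a ⬝ᵥ x = 0) :
    ∃ s t : K, x = s • u + t • v := by
  have hdet := (exists_dotProduct_iff_exists_combination u v x).1 ⟨a, ha, hau, hav, hax⟩
  obtain ⟨c, hc, hc'⟩ := Matrix.exists_vecMul_eq_zero_iff.2 hdet
  have hsum : ∀ j, c 0 * u j + c 1 * v j + c 2 * x j = 0 := by
    intro j
    have := congrFun hc' j
    simpa [Matrix.vecMul, dotProduct, Fin.sum_univ_three] using this
  by_cases h2 : c 2 = 0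
  · exfalso
    by_cases h0 : c 0 = 0
    · by_cases h1 : c 1 = 0
      · exact hc (by ext i; fin_cases i <;> assumption)
      · apply hv
        ext j
        simpa [h0, h2, h1] using hsum j
    · apply huv
      refine (pt_eq_pt hu hv).2 ⟨- c 1 / c 0, ?_⟩
      ext j
      have := hsum j
      simp only [h2, zero_mul, add_zero, Pi.smul_apply, smul_eq_mul] at this ⊢
      field_simp
      linear_combination -this
  · refine ⟨-c 0 / c 2, -c 1 / c 2, ?_⟩
    ext j
    have := hsum j
    simp only [Pi.add_apply, Pi.smul_apply, smul_eq_mul]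
    field_simp
    linear_combination this

theorem infinite_zeroSet_linForm [Infinite K] (a : Fin 3 → K) :
    (zeroSet (linForm a)).Infinite := by
  have key : ∀ g : K → Fin 3 → K, (∀ t, g t ≠ 0) → (∀ t, a ⬝ᵥ g t = 0) →
      (∀ (s t c : K), c • g s = g t → s = t) → (zeroSet (linForm a)).Infinite := by
    intro g h0 h1 h2
    refine Set.infinite_of_injective_forall_mem (f := fun t => pt (g t)) (fun s t hst => ?_)
      fun t => ?_
    · obtain ⟨c, hc⟩ := (pt_eq_pt (h0 s) (h0 t)).1 hst
      exact (h2 t s c hc).symm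
    · rw [pt_mem_zeroSet (linForm_isHomogeneous a) (h0 t), eval_linForm, h1]
  by_cases h0 : a 0 = 0
  · by_cases h1 : a 1 = 0
    · refine key (fun t => ![1, t, 0]) (by simp) (fun t => ?_) fun s t c h => ?_
      · simp [dotProduct, Fin.sum_univ_three, h0, h1]
      · have e0 := congrFun h 0
        have e1 := congrFun h 1
        simp at e0 e1
        simpa [e0] using e1
    · refine key (fun t => ![1, -(a 2 * t) / a 1, t]) (by simp) (fun t => ?_) fun s t c h => ?_
      · simp [dotProduct, Fin.sum_univ_three, h0]
        field_simp; ring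
      · have e0 := congrFun h 0
        have e1 := congrFun h 2
        simp at e0 e1
        simpa [e0] using e1
  · refine key (fun t => ![-(a 1 + a 2 * t) / a 0, 1, t]) (by simp) (fun t => ?_) fun s t c h => ?_
    · simp [dotProduct, Fin.sum_univ_three]
      field_simp; ring
    · have e0 := congrFun h 1
      have e1 := congrFun h 2
      simp at e0 e1
      simpa [e0] using e1

/-- The restriction of `f` to the affine line `t ↦ u + t v`. -/
noncomputable def restrictLine (f : MvPolynomial (Fin 3) K) (u v : Fin 3 → K) : Polynomial K :=
  aeval (fun i => Polynomial.C (u i) + Polynomial.C (v i) * Polynomial.X) f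

theorem eval_restrictLine (f : MvPolynomial (Fin 3) K) (u v : Fin 3 → K) (t : K) :
    (restrictLine f u v).eval t = eval (u + t • v) f := by
  rw [← Polynomial.coe_aeval_eq_eval, ← coe_aeval_eq_eval]
  change (Polynomial.aeval t) ((aeval _) f) = aeval _ f
  rw [← AlgHom.restrictScalars_apply K, ← AlgHom.comp_apply, comp_aeval]
  congr 2
  ext k
  simp only [AlgHom.restrictScalars_apply, map_add, map_mul, Polynomial.aeval_C, Polynomial.aeval_X,
    Algebra.algebraMap_self, RingHom.id_apply, Pi.add_apply, Pi.smul_apply, smul_eq_mul]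
  ring

theorem natDegree_restrictLine_le {f : MvPolynomial (Fin 3) K} {d : ℕ} (hf : f.IsHomogeneous d)
    (u v : Fin 3 → K) : (restrictLine f u v).natDegree ≤ d := by
  rw [restrictLine, aeval_def, eval₂_eq']
  refine Polynomial.natDegree_sum_le_of_forall_le _ _ fun m hm => ?_
  refine (Polynomial.natDegree_C_mul_le _ _).trans ((Polynomial.natDegree_prod_le _ _).trans ?_)
  have hd := hf.degree_eq_sum_deg_support hm
  calc _ ≤ ∑ i, m i * 1 := Finset.sum_le_sum fun i _ => Polynomial.natDegree_pow_le_of_le _ (by compute_degree)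
    _ ≤ d := by
      simp only [mul_one, hd]
      exact (Finset.sum_subset (Finset.subset_univ _) fun i _ hi => by simpa using hi).ge

theorem zeroSet_eq_of_subset [Infinite K] {f g : MvPolynomial (Fin 3) K} {d e : ℕ}
    (hf : f.IsHomogeneous d) (hg : g.IsHomogeneous e) (hfi : Irreducible f) (hgi : Irreducible g)
    (hinf : (zeroSet f ∩ zeroSet g).Infinite) : zeroSet f = zeroSet g := by
  have : f ∣ g := by
    by_contra h
    exact hinf (finite_zeroSet_inter hf hg hfi h)
  exact zeroSet_eq_of_associated (hfi.associated_of_dvd hgi this)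

/-- A line `L` meets another irreducible curve of degree `d` in at most `d` points. A point `v` of `L`
outside a set of `d + 1` common points is moved to infinity; the restriction of the form to the affine
line `L ∖ {v}` is a polynomial of degree at most `d` with `d + 1` roots, hence zero. So the curve contains
`L ∖ {v}`, an infinite set, and equals `L`. -/
theorem encard_line_inter_zeroSet_le [Infinite K] {a : Fin 3 → K} (ha : a ≠ 0)
    {f : MvPolynomial (Fin 3) K} {d : ℕ} (hf : f.IsHomogeneous d) (hfi : Irreducible f)
    (hne : zeroSet f ≠ zeroSet (linForm a)) :
    (zeroSet (linForm a) ∩ zeroSet f).encard ≤ d := by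
  classical
  by_contra! hlt
  obtain ⟨t, hts, htc⟩ := Set.exists_subset_encard_eq (k := (d + 1 : ℕ))
    (s := zeroSet (linForm a) ∩ zeroSet f) (by exact_mod_cast Order.add_one_le_of_lt hlt)
  have htf : t.Finite := Set.finite_of_encard_eq_coe htc
  obtain ⟨Q, hQ, hQt⟩ := ((infinite_zeroSet_linForm a).sdiff htf).nonempty
  obtain ⟨P, hP, hPQ⟩ := ((infinite_zeroSet_linForm a).sdiff (Set.finite_singleton Q)).nonempty
  obtain ⟨v, hv, rfl⟩ := exists_pt Q
  obtain ⟨u, hu, rfl⟩ := exists_pt P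
  have hl := linForm_isHomogeneous a
  have hau : a ⬝ᵥ u = 0 := by simpa using (pt_mem_zeroSet hl hu).1 hP
  have hav : a ⬝ᵥ v = 0 := by simpa using (pt_mem_zeroSet hl hv).1 hQ
  have hne0 : ∀ s : K, u + s • v ≠ 0 := by
    intro s h
    exact hPQ ((pt_eq_pt hu hv).2 ⟨-s, by rw [neg_smul]; exact (eq_neg_of_add_eq_zero_left h).symm⟩)
  have hinj : Function.Injective fun s : K => pt (u + s • v) := by
    intro s s' h
    obtain ⟨c, hc⟩ := (pt_eq_pt (hne0 s) (hne0 s')).1 h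
    by_contra hss
    have hcu : (c - 1) • u = (s - c * s') • v := by
      simp only [smul_add, smul_smul] at hc
      rw [sub_smul, sub_smul, one_smul]
      linear_combination (exp := 1) hc
    by_cases hc1 : c - 1 = 0
    · rw [hc1, zero_smul] at hcu
      have := (smul_eq_zero.1 hcu.symm).resolve_right hv
      rw [sub_eq_zero.1 hc1] at this
      exact hss (by linear_combination this)
    · refine hPQ ((pt_eq_pt hu hv).2 ⟨(s - c * s') / (c - 1), ?_⟩)
      rw [div_eq_inv_mul, mul_smul, ← hcu, smul_smul, inv_mul_cancel₀ hc1, one_smul]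
  have hmem : ∀ s, pt (u + s • v) ∈ zeroSet f ↔ (restrictLine f u v).eval s = 0 := by
    intro s
    rw [pt_mem_zeroSet hf (hne0 s), eval_restrictLine]
  have htsub : t ⊆ (fun s : K => pt (u + s • v)) '' {s | (restrictLine f u v).eval s = 0} := by
    intro R hR
    obtain ⟨x, hx, rfl⟩ := exists_pt R
    have hRs := hts hR
    have hax : a ⬝ᵥ x = 0 := by simpa using (pt_mem_zeroSet hl hx).1 hRs.1
    obtain ⟨s, r, rfl⟩ := mem_span_pair_of_dotProduct ha hu hv (fun h => hPQ h) hau hav hax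
    have hs : s ≠ 0 := by
      rintro rfl
      rw [zero_smul, zero_add] at hR hx
      have hr : r ≠ 0 := fun h => hx (by rw [h, zero_smul])
      rw [pt_smul hr hv] at hR
      exact hQt hR
    have he : pt (s • u + r • v) = pt (u + (r / s) • v) := by
      rw [← pt_smul hs (hne0 (r / s)), smul_add, smul_smul, mul_div_cancel₀ _ hs]
    refine ⟨r / s, ?_, he.symm⟩
    rw [Set.mem_ofPred_eq, ← hmem, ← he]
    exact hRs.2
  have hp0 : restrictLine f u v = 0 := by
    by_contra hp
    have h1 : ((fun s : K => pt (u + s • v)) '' {s | (restrictLine f u v).eval s = 0}).encard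
        ≤ d := by
      refine (Set.encard_image_le _ _).trans ?_
      have : {s | (restrictLine f u v).eval s = 0} = ((restrictLine f u v).roots.toFinset : Set K) := by
        ext s; simp [hp]
      rw [this, Set.encard_coe_eq_coe_finsetCard]
      exact_mod_cast (Multiset.toFinset_card_le _).trans
        ((Polynomial.card_roots' _).trans (natDegree_restrictLine_le hf u v))
    have h2 := (Set.encard_le_encard htsub).trans h1
    rw [htc] at h2
    have : d + 1 ≤ d := by exact_mod_cast h2
    omega
  refine hne (zeroSet_eq_of_subset hf hl hfi
    (irreducible_of_isHomogeneous_one hl (linForm_ne_zero ha)) ?_)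
  refine Set.infinite_of_injective_forall_mem hinj fun s => ⟨?_, ?_⟩
  · rw [hmem, hp0, Polynomial.eval_zero]
  · rw [pt_mem_zeroSet hl (hne0 s), eval_linForm, dotProduct_add, dotProduct_smul, hau, hav]
    simp

/-! ### Irreducible closed sets -/

/-- The top components multiply, with respect to any upper bounds of the total degrees. -/
theorem homogeneousComponent_mul_of_totalDegree_le {σ R : Type*} [CommSemiring R]
    {g h : MvPolynomial σ R} {a b : ℕ} (ha : g.totalDegree ≤ a) (hb : h.totalDegree ≤ b) :
    homogeneousComponent (a + b) (g * h) = homogeneousComponent a g * homogeneousComponent b h := by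
  have expand : ∀ (p : MvPolynomial σ R) (c : ℕ), p.totalDegree ≤ c →
      p = ∑ i ∈ Finset.range (c + 1), homogeneousComponent i p := by
    intro p c hc
    conv_lhs => rw [← sum_homogeneousComponent p]
    refine Finset.sum_subset (Finset.range_mono (by omega)) fun i _ hi => ?_
    exact homogeneousComponent_eq_zero _ _ (by simpa using hi)
  conv_lhs => rw [expand g a ha, expand h b hb, Finset.sum_mul_sum, map_sum]
  rw [Finset.sum_eq_single a]
  · rw [map_sum, Finset.sum_eq_single b]
    · rw [homogeneousComponent_of_mem ((homogeneousComponent_isHomogeneous a g).mul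
        (homogeneousComponent_isHomogeneous b h)), if_pos rfl]
    · intro j hj hjb
      rw [homogeneousComponent_of_mem ((homogeneousComponent_isHomogeneous a g).mul
        (homogeneousComponent_isHomogeneous j h)), if_neg (by omega)]
    · intro h; simp at h
  · intro i hi hia
    rw [map_sum]
    refine Finset.sum_eq_zero fun j hj => ?_
    rw [Finset.mem_range] at hi hj
    rw [homogeneousComponent_of_mem ((homogeneousComponent_isHomogeneous i g).mul
        (homogeneousComponent_isHomogeneous j h)), if_neg (by omega)]
  · intro h; simp at h

theorem isZariskiClosed_zeroSet {f : MvPolynomial (Fin 3) K} {d : ℕ} (hf : f.IsHomogeneous d) :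
    IsZariskiClosed (zeroSet f) :=
  ⟨{f}, by rintro g rfl; exact ⟨d, hf⟩, by ext; simp⟩

theorem isZariskiClosed_singleton (P : Plane K) : IsZariskiClosed {P} := by
  refine ⟨{f | f.IsHomogeneous 1 ∧ P ∈ zeroSet f}, fun f hf => ⟨1, hf.1⟩, ?_⟩
  ext Q
  constructor
  · rintro rfl f hf
    exact hf.2
  · intro hQ
    by_contra hne
    obtain ⟨a, ha, ha'⟩ := exists_linForm_separating (P := P) (Q := Q) fun h => hne h.symm
    exact ha' (hQ _ ⟨linForm_isHomogeneous a, ha⟩)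

theorem zeroSet_isHomogeneous_zero {f : MvPolynomial (Fin 3) K} (hf : f.IsHomogeneous 0)
    (h0 : f ≠ 0) : zeroSet f = ∅ := by
  obtain ⟨c, rfl⟩ : ∃ c, f = C c := ⟨_, totalDegree_eq_zero_iff_eq_C.1 (by simpa using hf.totalDegree h0)⟩
  ext P
  simpa [zeroSet] using h0

/-- A finite set of points other than `P` lies on a form not passing through `P`. -/
theorem exists_form_through {t : Set (Plane K)} (ht : t.Finite) {P : Plane K} (hP : P ∉ t) :
    ∃ (f : MvPolynomial (Fin 3) K) (d : ℕ), f.IsHomogeneous d ∧ t ⊆ zeroSet f ∧ P ∉ zeroSet f := by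
  induction t, ht using Set.Finite.induction_on with
  | empty => exact ⟨1, 0, isHomogeneous_one _ _, Set.empty_subset _, by simp [zeroSet]⟩
  | @insert Q s _ _ ih =>
    obtain ⟨f, d, hf, hs, hPf⟩ := ih fun h => hP (Set.mem_insert_of_mem _ h)
    obtain ⟨a, ha, ha'⟩ := exists_linForm_separating (P := Q) (Q := P)
      fun h => hP (h ▸ Set.mem_insert _ _)
    refine ⟨linForm a * f, _, (linForm_isHomogeneous a).mul hf, ?_, ?_⟩
    · rw [zeroSet_mul]
      exact Set.insert_subset (Or.inl ha) (hs.trans Set.subset_union_right)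
    · rw [zeroSet_mul]
      rintro (h | h)
      exacts [ha' h, hPf h]

theorem IsIrreducibleClosed.eq_singleton_of_finite {Z : Set (Plane K)} (hZ : IsIrreducibleClosed Z)
    (hfin : Z.Finite) : ∃ P, Z = {P} := by
  obtain ⟨-, ⟨P, hP⟩, hirr⟩ := hZ
  obtain ⟨f, d, hf, hs, hPf⟩ := exists_form_through (hfin.sdiff (t := {P})) (P := P) (by simp)
  refine ⟨P, ?_⟩
  have hcov : Z ⊆ {P} ∪ zeroSet f := by
    intro Q hQ
    by_cases hQP : Q = P
    · exact Or.inl hQP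
    · exact Or.inr (hs ⟨hQ, hQP⟩)
  rcases hirr {P} (zeroSet f) (isZariskiClosed_singleton P) (isZariskiClosed_zeroSet hf) hcov
    with h | h
  · exact h.antisymm (Set.singleton_subset_iff.2 hP)
  · exact absurd (h hP) hPf

theorem isIrreducibleClosed_singleton (P : Plane K) : IsIrreducibleClosed {P} := by
  refine ⟨isZariskiClosed_singleton P, Set.singleton_nonempty P, fun X Y _ _ h => ?_⟩
  simpa using h

/-- An infinite curve cut out by an irreducible form is irreducible in the Zariski topology. -/
theorem isIrreducibleClosed_zeroSet [Infinite K] {f : MvPolynomial (Fin 3) K} {d : ℕ}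
    (hf : f.IsHomogeneous d) (hfi : Irreducible f) (hinf : (zeroSet f).Infinite) :
    IsIrreducibleClosed (zeroSet f) := by
  refine ⟨isZariskiClosed_zeroSet hf, hinf.nonempty, ?_⟩
  rintro X Y ⟨S, hS, rfl⟩ ⟨S', hS', rfl⟩ hXY
  by_contra! hcon
  have key : ∀ S : Set (MvPolynomial (Fin 3) K), ¬ zeroSet f ⊆ {P | ∀ g ∈ S, P ∈ zeroSet g} →
      ∃ g ∈ S, ¬ f ∣ g := by
    intro S hS
    by_contra! H
    exact hS fun P hP g hg => zeroSet_subset_of_dvd (H g hg) hP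
  obtain ⟨g, hg, hfg⟩ := key S hcon.1
  obtain ⟨h, hh, hfh⟩ := key S' hcon.2
  obtain ⟨a, ha⟩ := hS g hg
  obtain ⟨b, hb⟩ := hS' h hh
  have hfin := finite_zeroSet_inter hf (ha.mul hb) hfi
    fun hd => (hfi.prime.dvd_or_dvd hd).elim hfg hfh
  refine hinf (hfin.subset fun P hP => ⟨hP, ?_⟩)
  rw [zeroSet_mul]
  exact (hXY hP).imp (fun H => H g hg) (fun H => H h hh)

/-- If a form of degree `d` vanishes on an irreducible closed set, then so does an irreducible form of
degree at most `d`. For a proper factorization `f = g * h` of the form, the top components of `g` and `h`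
are forms with product `f`, so one of them vanishes on the set, and its degree is smaller. -/
theorem IsIrreducibleClosed.exists_irreducible {Z : Set (Plane K)} (hZ : IsIrreducibleClosed Z)
    {f : MvPolynomial (Fin 3) K} {d : ℕ} (hf : f.IsHomogeneous d) (h0 : f ≠ 0) (hZf : Z ⊆ zeroSet f) :
    ∃ (g : MvPolynomial (Fin 3) K) (e : ℕ), e ≤ d ∧ g.IsHomogeneous e ∧ Irreducible g ∧
      Z ⊆ zeroSet g := by
  induction d using Nat.strong_induction_on generalizing f with
  | _ d ih =>
  by_cases hfi : Irreducible f
  · exact ⟨f, d, le_rfl, hf, hfi, hZf⟩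
  have hfu : ¬ IsUnit f := by
    intro hu
    have h1 := (isUnit_iff_totalDegree_of_isReduced.1 hu).2
    rw [hf.totalDegree h0] at h1
    subst h1
    rw [zeroSet_isHomogeneous_zero hf h0] at hZf
    exact hZ.2.1.not_subset_empty hZf
  rw [irreducible_iff] at hfi
  push Not at hfi
  obtain ⟨g, h, rfl, hg, hh⟩ := hfi hfu
  have hg0 : g ≠ 0 := left_ne_zero_of_mul h0
  have hh0 : h ≠ 0 := right_ne_zero_of_mul h0
  have hdeg := hf.totalDegree h0
  rw [totalDegree_mul_of_isDomain hg0 hh0] at hdeg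
  have pos : ∀ p : MvPolynomial (Fin 3) K, p ≠ 0 → ¬ IsUnit p → 0 < p.totalDegree := by
    intro p hp hu
    rw [pos_iff_ne_zero]
    intro h
    rw [totalDegree_eq_zero_iff_eq_C] at h
    rw [h] at hp hu
    exact hu ((isUnit_iff_ne_zero.2 (fun h' => hp (by rw [h', map_zero]))).map C)
  have hgp := pos g hg0 hg
  have hhp := pos h hh0 hh
  have hprod := homogeneousComponent_mul_of_totalDegree_le (le_refl g.totalDegree)
    (le_refl h.totalDegree)
  rw [hdeg, homogeneousComponent_eq_self hf] at hprod
  rw [hprod] at h0 hZf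
  rw [zeroSet_mul] at hZf
  have hgh := homogeneousComponent_isHomogeneous g.totalDegree g
  have hhh := homogeneousComponent_isHomogeneous h.totalDegree h
  rcases hZ.2.2 _ _ (isZariskiClosed_zeroSet hgh) (isZariskiClosed_zeroSet hhh) hZf with H | H
  · obtain ⟨p, e, he, hp⟩ := ih _ (by omega) hgh (left_ne_zero_of_mul h0) H
    exact ⟨p, e, by omega, hp⟩
  · obtain ⟨p, e, he, hp⟩ := ih _ (by omega) hhh (right_ne_zero_of_mul h0) H
    exact ⟨p, e, by omega, hp⟩

/-- The extra factor `X 0` takes care of the zero vector, which represents no point. -/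
theorem zeroSet_ne_univ [Infinite K] {f : MvPolynomial (Fin 3) K} {d : ℕ} (hf : f.IsHomogeneous d)
    (h0 : f ≠ 0) : zeroSet f ≠ Set.univ := by
  intro h
  apply mul_ne_zero h0 (X_ne_zero (0 : Fin 3))
  refine MvPolynomial.funext fun x => ?_
  by_cases hx : x = 0
  · simp [hx]
  · have : pt x ∈ zeroSet f := by rw [h]; trivial
    rw [pt_mem_zeroSet hf hx] at this
    simp [this]

/-- Over an infinite field the irreducible closed proper subsets of bounded degree are the points and the
infinite curves of bounded degree. -/
theorem mem_zariskiVar_iff [Infinite K] {n : ℕ} {Z : Set (Plane K)} :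
    Z ∈ ZariskiVar K n ↔ (∃ P, Z = {P}) ∨ ∃ (f : MvPolynomial (Fin 3) K) (d : ℕ), d ≤ n ∧
      f.IsHomogeneous d ∧ Irreducible f ∧ (zeroSet f).Infinite ∧ Z = zeroSet f := by
  constructor
  · rintro ⟨hZ, -, hP | ⟨f, d, hd, hf, h0, hZf⟩⟩
    · exact Or.inl hP
    by_cases hfin : Z.Finite
    · exact Or.inl (hZ.eq_singleton_of_finite hfin)
    right
    obtain ⟨g, e, he, hg, hgi, hZg⟩ := hZ.exists_irreducible hf h0 hZf
    refine ⟨g, e, he.trans hd, hg, hgi, Set.Infinite.mono hZg hfin, hZg.antisymm ?_⟩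
    obtain ⟨S, hS, rfl⟩ := hZ.1
    intro P hP h hh
    obtain ⟨b, hb⟩ := hS h hh
    by_cases hgh : g ∣ h
    · exact zeroSet_subset_of_dvd hgh hP
    · exact absurd ((finite_zeroSet_inter hg hb hgi hgh).subset fun Q hQ => ⟨hZg hQ, hQ h hh⟩) hfin
  · rintro (⟨P, rfl⟩ | ⟨f, d, hd, hf, hfi, hinf, rfl⟩)
    · refine ⟨isIrreducibleClosed_singleton P, fun h => ?_, Or.inl ⟨P, rfl⟩⟩
      obtain ⟨Q, -, hQ⟩ := ((infinite_zeroSet_linForm (0 : Fin 3 → K)).sdiff (Set.finite_singleton P)).nonempty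
      exact hQ (h ▸ Set.mem_univ Q)
    · exact ⟨isIrreducibleClosed_zeroSet hf hfi hinf, zeroSet_ne_univ hf hfi.ne_zero,
        Or.inr ⟨f, d, hd, hf, hfi.ne_zero, subset_rfl⟩⟩

theorem pos_of_irreducible_of_isHomogeneous {f : MvPolynomial (Fin 3) K} {d : ℕ} (hfi : Irreducible f)
    (hf : f.IsHomogeneous d) : 0 < d := by
  rw [pos_iff_ne_zero]
  rintro rfl
  have h := totalDegree_eq_zero_iff_eq_C.1 (hf.totalDegree hfi.ne_zero)
  apply hfi.not_isUnit
  have h0 := hfi.ne_zero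
  rw [h] at h0 ⊢
  exact (isUnit_iff_ne_zero.2 (fun h' => h0 (by rw [h', map_zero]))).map C

theorem eval_smul_of_isHomogeneous {f : MvPolynomial (Fin 3) K} {d : ℕ} (hf : f.IsHomogeneous d) (c : K)
    (x : Fin 3 → K) : eval (c • x) f = c ^ d * eval x f := by
  rw [eval_eq', eval_eq', Finset.mul_sum]
  refine Finset.sum_congr rfl fun m hm => ?_
  have hd := hf.degree_eq_sum_deg_support hm
  rw [Finset.sum_subset (Finset.subset_univ _) fun i _ hi => by simpa using hi] at hd
  simp only [Pi.smul_apply, smul_eq_mul, mul_pow, Finset.prod_mul_distrib,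
    Finset.prod_pow_eq_pow_sum, ← hd]
  ring

/-- Over an algebraically closed field every line through a point `P` off the curve meets
the curve, and these intersection points are distinct. -/
theorem infinite_zeroSet_of_isAlgClosed [IsAlgClosed K] {f : MvPolynomial (Fin 3) K} {d : ℕ}
    (hf : f.IsHomogeneous d) (hfi : Irreducible f) : (zeroSet f).Infinite := by
  have : Infinite K := IsAlgClosed.instInfinite
  obtain ⟨p, hp0, hp⟩ : ∃ p : Fin 3 → K, p ≠ 0 ∧ eval p f ≠ 0 := by
    by_contra! H
    refine zeroSet_ne_univ hf hfi.ne_zero (Set.eq_univ_of_forall fun P => ?_)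
    obtain ⟨x, hx, rfl⟩ := exists_pt P
    exact (pt_mem_zeroSet hf hx).2 (H x hx)
  -- A polynomial without roots is constant. If `f (w + s p)` is a constant `c`, then by homogeneity
  -- `f (p + r w) = c r ^ d`, which gives `f p = 0` at `r = 0`.
  have hroot : ∀ w : Fin 3 → K, ∃ s : K, eval (w + s • p) f = 0 := by
    intro w
    by_contra! H
    have hdeg : (restrictLine f w p).degree = 0 := by
      by_contra hd
      obtain ⟨s, hs⟩ := IsAlgClosed.exists_root _ hd
      exact H s (by rw [← eval_restrictLine]; exact hs)
    obtain ⟨c, hc⟩ : ∃ c, restrictLine f w p = Polynomial.C c := ⟨_, Polynomial.eq_C_of_degree_eq_zero hdeg⟩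
    have hq : restrictLine f p w = Polynomial.C c * Polynomial.X ^ d := by
      refine Polynomial.eq_of_infinite_eval_eq _ _ ((Set.finite_singleton (0 : K)).infinite_compl.mono ?_)
      intro r hr
      have hr : r ≠ 0 := hr
      have h1 := eval_restrictLine f w p r⁻¹
      have h2 := eval_smul_of_isHomogeneous hf r (w + r⁻¹ • p)
      rw [smul_add, smul_smul, mul_inv_cancel₀ hr, one_smul, ← h1, hc, Polynomial.eval_C, add_comm] at h2
      rw [Set.mem_ofPred_eq, eval_restrictLine, h2]
      rw [Polynomial.eval_mul, Polynomial.eval_C, Polynomial.eval_pow, Polynomial.eval_X, mul_comm]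
    have h3 := eval_restrictLine f p w 0
    rw [hq] at h3
    simp [(pos_of_irreducible_of_isHomogeneous hfi hf).ne'] at h3
    exact hp h3.symm
  obtain ⟨i, hi⟩ : ∃ i, p i ≠ 0 := by
    by_contra! H
    exact hp0 (funext H)
  obtain ⟨j, k, hij, hik, hjk⟩ : ∃ j k : Fin 3, i ≠ j ∧ i ≠ k ∧ j ≠ k := by
    clear hi; revert i; decide
  let w : K → Fin 3 → K := fun t => Pi.single j 1 + t • Pi.single k 1
  choose s hs using fun t => hroot (w t)
  have hwi : ∀ t, w t i = 0 := fun t => by simp [w, hij, hik]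
  have hwj : ∀ t, w t j = 1 := fun t => by simp [w, hjk]
  have hwk : ∀ t, w t k = t := fun t => by simp [w, hjk.symm]
  have hne : ∀ t, w t + s t • p ≠ 0 := by
    intro t h
    have h1 := congrFun h i
    have h2 := congrFun h j
    simp only [Pi.add_apply, Pi.smul_apply, smul_eq_mul, hwi, hwj, Pi.zero_apply, zero_add,
      mul_eq_zero, hi, or_false] at h1 h2
    simp [h1] at h2
  refine Set.infinite_of_injective_forall_mem (f := fun t => pt (w t + s t • p)) (fun t t' h => ?_)
    fun t => (pt_mem_zeroSet hf (hne t)).2 (hs t)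
  obtain ⟨c, hc⟩ := (pt_eq_pt (hne t) (hne t')).1 h
  have h1 := congrFun hc i
  have h2 := congrFun hc j
  have h3 := congrFun hc k
  simp only [Pi.add_apply, Pi.smul_apply, smul_eq_mul, hwi, hwj, hwk, zero_add] at h1 h2 h3
  have h4 : c * s t' = s t := mul_right_cancel₀ hi (by linear_combination h1)
  have h5 : c = 1 := by linear_combination h2 - p j * h4
  linear_combination -h3 + p k * h4 + t' * h5

/-! ### Interpolating curves -/

/-- The collineation of the plane induced by a linear automorphism. -/
noncomputable def planeMap (T : (Fin 3 → K) ≃ₗ[K] (Fin 3 → K)) : Plane K → Plane K :=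
  Projectivization.map T.toLinearMap T.injective

theorem planeMap_pt (T : (Fin 3 → K) ≃ₗ[K] (Fin 3 → K)) {x : Fin 3 → K} (hx : x ≠ 0) :
    planeMap T (pt x) = pt (T x) := by
  rw [pt_of_ne hx, pt_of_ne ((map_ne_zero_iff _ T.injective).2 hx), planeMap, Projectivization.map_mk]
  rfl

theorem planeMap_injective (T : (Fin 3 → K) ≃ₗ[K] (Fin 3 → K)) : Function.Injective (planeMap T) :=
  Projectivization.map_injective T.toLinearMap T.injective

theorem zeroSet_linSub_symm (T : (Fin 3 → K) ≃ₗ[K] (Fin 3 → K)) {f : MvPolynomial (Fin 3) K} {d : ℕ}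
    (hf : f.IsHomogeneous d) :
    zeroSet (linSub T.symm.toLinearMap f) = planeMap T '' zeroSet f := by
  ext P
  obtain ⟨y, hy, rfl⟩ := exists_pt P
  obtain ⟨x, rfl⟩ := T.surjective y
  have hx : x ≠ 0 := (map_ne_zero_iff _ T.injective).1 hy
  rw [pt_map_mem_zeroSet T hf hx, ← planeMap_pt T hx, (planeMap_injective T).mem_set_image,
    pt_mem_zeroSet hf hx]

theorem exists_linearEquiv {u v w : Fin 3 → K} (h : (Matrix.of ![u, v, w]).det ≠ 0) :
    ∃ T : (Fin 3 → K) ≃ₗ[K] (Fin 3 → K), ∀ x, T x = x 0 • u + x 1 • v + x 2 • w := by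
  have hli : LinearIndependent K ![u, v, w] :=
    Matrix.linearIndependent_rows_of_det_ne_zero h
  refine ⟨(basisOfLinearIndependentOfCardEqFinrank hli (by simp)).equivFun.symm, fun x => ?_⟩
  simp [Module.Basis.equivFun_symm_apply, Fin.sum_univ_three]

theorem exists_forall_eval_ne_zero [Infinite K] {ι : Type*} (s : Finset ι)
    (f : ι → MvPolynomial (Fin 3) K) (hf : ∀ i ∈ s, f i ≠ 0) :
    ∃ x, ∀ i ∈ s, eval x (f i) ≠ 0 := by
  have h : ∏ i ∈ s, f i ≠ 0 := Finset.prod_ne_zero_iff.2 hf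
  obtain ⟨x, hx⟩ : ∃ x, eval x (∏ i ∈ s, f i) ≠ 0 := by
    by_contra! H
    exact h (MvPolynomial.funext fun x => by simpa using H x)
  rw [map_prod, Finset.prod_ne_zero_iff] at hx
  exact ⟨x, hx⟩

/-- The form `∑ bₖ x₀ᵏ x₂^(m-k) - x₁ x₂^(m-1)`, whose affine part is the graph of `B`. -/
noncomputable def graphForm (B : Polynomial K) (m : ℕ) : MvPolynomial (Fin 3) K :=
  -X 2 ^ (m - 1) * X 1 + ∑ k ∈ Finset.range (m + 1), C (B.coeff k) * (X 0 ^ k * X 2 ^ (m - k))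

theorem graphForm_isHomogeneous (B : Polynomial K) {m : ℕ} (hm : 0 < m) :
    (graphForm B m).IsHomogeneous m := by
  refine IsHomogeneous.add ?_ (IsHomogeneous.sum _ _ _ fun k hk => ?_)
  · have := ((isHomogeneous_X_pow (R := K) (2 : Fin 3) (m - 1)).neg).mul (isHomogeneous_X K (1 : Fin 3))
    rwa [Nat.sub_add_cancel hm] at this
  · have hk' : k ≤ m := Nat.lt_succ_iff.1 (Finset.mem_range.1 hk)
    have := ((isHomogeneous_X_pow (R := K) (0 : Fin 3) k).mul
      (isHomogeneous_X_pow (2 : Fin 3) (m - k))).C_mul (B.coeff k)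
    rwa [Nat.add_sub_cancel' hk'] at this

theorem eval_graphForm (B : Polynomial K) {m : ℕ} (hm : 0 < m) (hB : B.natDegree ≤ m)
    {x : Fin 3 → K} (hx : x 2 ≠ 0) :
    eval x (graphForm B m) = x 2 ^ m * (B.eval (x 0 / x 2) - x 1 / x 2) := by
  rw [Polynomial.eval_eq_sum_range' (Nat.lt_succ_iff.2 hB), mul_sub, Finset.mul_sum, graphForm]
  simp only [map_add, map_mul, map_neg, map_pow, eval_X, map_sum, eval_C]
  rw [add_comm, sub_eq_add_neg]
  congr 1
  · refine Finset.sum_congr rfl fun k hk => ?_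
    have hk' : k ≤ m := Nat.lt_succ_iff.1 (Finset.mem_range.1 hk)
    rw [← pow_sub_mul_pow (x 2) hk', div_pow]
    field_simp
  · obtain ⟨m, rfl⟩ := Nat.exists_eq_succ_of_ne_zero hm.ne'
    rw [Nat.succ_eq_add_one, Nat.add_sub_cancel, pow_succ]
    field_simp

/-- As a polynomial in `x₁` the form has degree one, with leading coefficient a power of `x₂`. A common
factor of its two coefficients would be divisible by `x₂`, while the constant one contains `x₀ ^ m`. -/
theorem irreducible_graphForm (B : Polynomial K) {m : ℕ} (h : m = 1 ∨ B.coeff m ≠ 0) :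
    Irreducible (graphForm B m) := by
  have key : ∀ p : MvPolynomial (Fin 3) K, p ∈ supported K ({0, 2} : Set (Fin 3)) → 1 ∉ p.vars := by
    intro p hp h1
    simpa using mem_supported.1 hp h1
  have h0 : (X 0 : MvPolynomial (Fin 3) K) ∈ supported K ({0, 2} : Set (Fin 3)) :=
    X_mem_supported.2 (by simp)
  have h2 : (X 2 : MvPolynomial (Fin 3) K) ∈ supported K ({0, 2} : Set (Fin 3)) :=
    X_mem_supported.2 (by simp)
  refine irreducible_mul_X_add _ _ _ (neg_ne_zero.2 (pow_ne_zero _ (X_ne_zero _)))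
    (key _ (neg_mem (pow_mem h2 _))) (key _ (sum_mem fun k _ => mul_mem
      (Subalgebra.algebraMap_mem _ _) (mul_mem (pow_mem h0 _) (pow_mem h2 _)))) ?_
  intro p hp hp'
  rw [dvd_neg] at hp
  obtain ⟨j, -, hj⟩ := (dvd_prime_pow (X_prime (R := K) (i := (2 : Fin 3))) _).1 hp
  rcases Nat.eq_zero_or_pos j with rfl | hj0
  · rw [pow_zero] at hj
    exact hj.symm.isUnit isUnit_one
  · rcases h with rfl | h
    · exact isUnit_of_dvd_one (by simpa using hp)
    · exfalso
      obtain ⟨q, hq⟩ := ((dvd_pow_self _ hj0.ne').trans hj.symm.dvd).trans hp'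
      have := congrArg (eval ![1, 0, 0]) hq
      rw [map_sum, Finset.sum_eq_single m] at this
      · simp at this
        exact h this
      · intro k hk hkm
        have : k < m := lt_of_le_of_ne (Nat.lt_succ_iff.1 (Finset.mem_range.1 hk)) hkm
        simp [Nat.sub_ne_zero_of_lt this]
      · simp

theorem infinite_zeroSet_graphForm [Infinite K] (B : Polynomial K) {m : ℕ} (hm : 0 < m)
    (hB : B.natDegree ≤ m) : (zeroSet (graphForm B m)).Infinite := by
  have hne : ∀ t : K, (![t, B.eval t, 1] : Fin 3 → K) ≠ 0 := fun t => by simp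
  refine Set.infinite_of_injective_forall_mem (f := fun t => pt ![t, B.eval t, 1])
    (fun s t h => ?_) fun t => ?_
  · obtain ⟨c, hc⟩ := (pt_eq_pt (hne s) (hne t)).1 h
    have h0 := congrFun hc 0
    have h2 := congrFun hc 2
    simp at h0 h2
    rw [← h0, h2, one_mul]
  · rw [pt_mem_zeroSet (graphForm_isHomogeneous B hm) (hne t), eval_graphForm B hm hB (by simp)]
    simp

/-- Lagrange interpolation: finitely many points in the affine plane, with different abscissas
`x₀ / x₂`, lie on the graph of a polynomial. -/
theorem exists_graphForm_through {n : ℕ} (hn : 0 < n) (w : Fin (n + 1) → Fin 3 → K)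
    (hw : ∀ i, w i 2 ≠ 0) (hw' : ∀ i j, i ≠ j → w i 0 * w j 2 ≠ w j 0 * w i 2) :
    ∃ (B : Polynomial K) (m : ℕ), 0 < m ∧ m ≤ n ∧ B.natDegree ≤ m ∧ (m = 1 ∨ B.coeff m ≠ 0) ∧
      ∀ i, eval (w i) (graphForm B m) = 0 := by
  have hinj : Set.InjOn (fun i => w i 0 / w i 2) (Finset.univ : Finset (Fin (n + 1))) := by
    intro i _ j _ hij
    by_contra hne
    simp only [div_eq_div_iff (hw i) (hw j)] at hij
    exact hw' i j hne hij
  let B := Lagrange.interpolate Finset.univ (fun i => w i 0 / w i 2) (fun i => w i 1 / w i 2)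
  have hB : B.natDegree ≤ n := by
    have h := Lagrange.degree_interpolate_lt (fun i => w i 1 / w i 2) hinj
    rw [Finset.card_univ, Fintype.card_fin] at h
    refine Polynomial.natDegree_le_iff_coeff_eq_zero.2 fun k hk => ?_
    exact Polynomial.coeff_eq_zero_of_degree_lt (h.trans_le (by exact_mod_cast hk))
  have hm : 0 < max 1 B.natDegree := by omega
  refine ⟨B, max 1 B.natDegree, hm, by omega, le_max_right _ _, ?_, fun i => ?_⟩
  · rcases le_or_gt B.natDegree 1 with h | h
    · exact Or.inl (max_eq_left h)
    · right
      rw [max_eq_right h.le, Polynomial.coeff_natDegree, Polynomial.leadingCoeff_ne_zero]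
      rintro h0
      rw [h0] at h
      simp at h
  · rw [eval_graphForm B hm (le_max_right _ _) (hw i)]
    rw [Lagrange.eval_interpolate_at_node _ hinj (Finset.mem_univ i), sub_self, mul_zero]

theorem crossProduct_ne_zero {u v : Fin 3 → K} (hu : u ≠ 0) (hv : v ≠ 0) (h : pt u ≠ pt v) :
    crossProduct u v ≠ 0 := by
  rw [crossProduct_ne_zero_iff_linearIndependent, LinearIndependent.pair_iff' hu]
  intro c hc
  exact h ((pt_eq_pt hv hu).2 ⟨c, hc⟩).symm

/-- Through any `n + 1` points of a curve that is not a line passes another irreducible curve of degree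
at most `n`. Choose coordinates for which the point `p = (0 : 1 : 0)` is neither on the curve nor on a
secant through two of the points, and for which the line at infinity, through `p`, avoids the points.
Then the abscissas of the points are different and the points lie on the graph of an interpolation
polynomial. The closure of this graph contains `p` if its degree is at least two, and is a line
otherwise, so it differs from the given curve. -/
theorem exists_curve_through [Infinite K] {n : ℕ} (hn : 0 < n) {f : MvPolynomial (Fin 3) K}
    {d : ℕ} (hf : f.IsHomogeneous d) (hf0 : f ≠ 0) (hline : ¬ IsLine (zeroSet f))
    {P : Fin (n + 1) → Plane K} (hP : Function.Injective P) :
    ∃ (g : MvPolynomial (Fin 3) K) (e : ℕ), e ≤ n ∧ g.IsHomogeneous e ∧ Irreducible g ∧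
      (zeroSet g).Infinite ∧ zeroSet g ≠ zeroSet f ∧ ∀ i, P i ∈ zeroSet g := by
  classical
  choose v hv hvP using fun i => exists_pt (P i)
  have hcross : ∀ i j, i ≠ j → crossProduct (v i) (v j) ≠ 0 := fun i j hij =>
    crossProduct_ne_zero (hv i) (hv j) fun h => hij (hP (by rw [← hvP, ← hvP, h]))
  -- `p` is off the curve and off the secants; the index `none` stands for the curve
  obtain ⟨p, hp⟩ := exists_forall_eval_ne_zero (Finset.univ : Finset (Option (Fin (n + 1) × Fin (n + 1))))
    (fun o => o.elim f fun ij => if ij.1 = ij.2 then 1 else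
      linForm (crossProduct (v ij.1) (v ij.2))) (by
      rintro (_ | ⟨i, j⟩) -
      · exact hf0
      · by_cases hij : i = j
        · simp [hij]
        · simpa [hij] using linForm_ne_zero (hcross i j hij))
  have hpf : eval p f ≠ 0 := hp none (Finset.mem_univ _)
  have hpv : ∀ i j, i ≠ j → crossProduct (v i) (v j) ⬝ᵥ p ≠ 0 := fun i j hij => by
    simpa [hij] using hp (some (i, j)) (Finset.mem_univ _)
  have hpv0 : ∀ i, crossProduct p (v i) ≠ 0 := by
    intro i h
    obtain ⟨j, hj⟩ : ∃ j, j ≠ i := by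
      have : Nontrivial (Fin (n + 1)) := Fin.nontrivial_iff_two_le.2 (by omega)
      exact exists_ne i
    apply hpv i j hj.symm
    rw [dotProduct_comm, triple_product_permutation, triple_product_permutation, h]
    simp
  -- the line through `p` and `q` avoids the points
  obtain ⟨q, hq⟩ := exists_forall_eval_ne_zero Finset.univ
    (fun i => linForm (crossProduct p (v i))) fun i _ => linForm_ne_zero (hpv0 i)
  have hq' : ∀ i, (Matrix.of ![q, p, v i]).det ≠ 0 := by
    intro i
    have := hq i (Finset.mem_univ i)
    rw [eval_linForm, dotProduct_comm, triple_product_eq_det] at this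
    exact this
  obtain ⟨T, hT⟩ := exists_linearEquiv (hq' 0)
  let w : Fin (n + 1) → Fin 3 → K := fun i => T.symm (v i)
  have hw : ∀ i, v i = w i 0 • q + w i 1 • p + w i 2 • v 0 := fun i => by
    rw [← hT, LinearEquiv.apply_symm_apply]
  have hw2 : ∀ i, w i 2 ≠ 0 := by
    intro i h
    apply hq' i
    rw [hw i, h, Matrix.det_fin_three]
    simp
    ring
  have hw02 : ∀ i j, i ≠ j → w i 0 * w j 2 ≠ w j 0 * w i 2 := by
    intro i j hij h
    apply hpv i j hij
    have h0 : ∀ k, v i k = w i 0 * q k + w i 1 * p k + w i 2 * v 0 k := fun k => by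
      conv_lhs => rw [hw i]
      simp
    have h1 : ∀ k, v j k = w j 0 * q k + w j 1 * p k + w j 2 * v 0 k := fun k => by
      conv_lhs => rw [hw j]
      simp
    simp only [cross_apply, dotProduct, Fin.sum_univ_three, h0, h1, Matrix.cons_val]
    linear_combination (p 0 * (q 1 * v 0 2 - q 2 * v 0 1) - p 1 * (q 0 * v 0 2 - q 2 * v 0 0) + p 2 * (q 0 * v 0 1 - q 1 * v 0 0)) * h
  obtain ⟨B, m, hm, hmn, hB, hBm, hBw⟩ := exists_graphForm_through hn w hw2 hw02
  have hg := graphForm_isHomogeneous B hm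
  refine ⟨linSub T.symm.toLinearMap (graphForm B m), m, hmn, linSub_isHomogeneous _ hg,
    irreducible_linSub T.symm (irreducible_graphForm B hBm), ?_, ?_, fun i => ?_⟩
  · rw [zeroSet_linSub_symm T hg]
    exact (infinite_zeroSet_graphForm B hm hB).image (planeMap_injective T).injOn
  · intro heq
    -- a graph of degree at least two passes through `p`
    rcases Nat.lt_or_ge 1 m with h1 | h1
    · have h010 : (![0, 1, 0] : Fin 3 → K) ≠ 0 := by simp
      have hTp : T ![0, 1, 0] = p := by rw [hT]; simp
      have hp0 : p ≠ 0 := by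
        rw [← hTp]; exact (map_ne_zero_iff _ T.injective).2 h010
      apply hpf
      rw [← pt_mem_zeroSet hf hp0, ← heq, ← hTp, pt_map_mem_zeroSet T hg h010, graphForm]
      simp only [map_add, map_mul, map_neg, map_pow, eval_X, map_sum, eval_C]
      rw [Finset.sum_eq_zero]
      · simp [(Nat.sub_pos_of_lt h1).ne']
      · intro k hk
        rcases Nat.eq_zero_or_pos k with rfl | hk0
        · simp [hm.ne']
        · simp [hk0.ne']
    · have hm1 : m = 1 := by omega
      subst hm1
      refine hline ⟨_, linSub_isHomogeneous _ hg,
        (irreducible_linSub T.symm (irreducible_graphForm B hBm)).ne_zero, heq.symm⟩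
  · rw [← hvP, ← T.apply_symm_apply (v i), pt_map_mem_zeroSet T hg]
    · exact hBw i
    · exact (map_ne_zero_iff _ T.symm.injective).2 (hv i)

/-! ### The families of curves -/

/-- The points of the plane, together with the zero sets of the irreducible forms of degree at most
`n` which have at least `m` points. Over an infinite field, both kinds of posets of varieties in question
are of this form: `m = 1` for `Var`, and for `ZariskiVar` any `m` above the bound for the finite zero sets,
so that having `m` points means being infinite. -/
def curveFamily (K : Type*) [Field K] (n m : ℕ) : Set (Set (Plane K)) :=
  {Z | (∃ P, Z = {P}) ∨ ∃ (f : MvPolynomial (Fin 3) K) (d : ℕ), d ≤ n ∧ f.IsHomogeneous d ∧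
    Irreducible f ∧ (m : ℕ∞) ≤ (zeroSet f).encard ∧ Z = zeroSet f}

theorem var_eq_curveFamily (n : ℕ) : Var K n = curveFamily K n 1 := by
  ext Z
  refine or_congr Iff.rfl ⟨?_, ?_⟩
  · rintro ⟨hne, f, d, hd, hf, hfi, rfl⟩
    exact ⟨f, d, hd, hf, hfi, by simpa [Set.one_le_encard_iff_nonempty] using hne, rfl⟩
  · rintro ⟨f, d, hd, hf, hfi, hm, rfl⟩
    exact ⟨by simpa [Set.one_le_encard_iff_nonempty] using hm, f, d, hd, hf, hfi, rfl⟩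

theorem zariskiVar_eq_curveFamily [Infinite K] {n N : ℕ}
    (hN : ∀ (f : MvPolynomial (Fin 3) K), ∀ d ≤ n, f.IsHomogeneous d →
      (zeroSet f).Finite → (zeroSet f).ncard ≤ N) : ZariskiVar K n = curveFamily K n (N + 1) := by
  ext Z
  rw [mem_zariskiVar_iff]
  refine or_congr Iff.rfl ⟨?_, ?_⟩
  · rintro ⟨f, d, hd, hf, hfi, hinf, rfl⟩
    exact ⟨f, d, hd, hf, hfi, by rw [hinf.encard_eq]; exact le_top, rfl⟩
  · rintro ⟨f, d, hd, hf, hfi, hm, rfl⟩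
    refine ⟨f, d, hd, hf, hfi, fun hfin => ?_, rfl⟩
    have h := hN f d hd hf hfin
    rw [← hfin.cast_ncard_eq] at hm
    have hm : N + 1 ≤ (zeroSet f).ncard := by exact_mod_cast hm
    omega

theorem zariskiVar_eq_var_of_isAlgClosed [IsAlgClosed K] (n : ℕ) : ZariskiVar K n = Var K n := by
  have : Infinite K := IsAlgClosed.instInfinite
  ext Z
  rw [mem_zariskiVar_iff]
  refine or_congr Iff.rfl ⟨?_, ?_⟩
  · rintro ⟨f, d, hd, hf, hfi, hinf, rfl⟩
    exact ⟨hinf.nonempty, f, d, hd, hf, hfi, rfl⟩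
  · rintro ⟨-, f, d, hd, hf, hfi, rfl⟩
    exact ⟨f, d, hd, hf, hfi, infinite_zeroSet_of_isAlgClosed hf hfi, rfl⟩

theorem singleton_mem_curveFamily {n m : ℕ} (P : Plane K) : {P} ∈ curveFamily K n m :=
  Or.inl ⟨P, rfl⟩

theorem nonempty_of_mem_curveFamily {n m : ℕ} (hm : 0 < m) {Z : Set (Plane K)}
    (hZ : Z ∈ curveFamily K n m) : Z.Nonempty := by
  rcases hZ with ⟨P, rfl⟩ | ⟨f, d, -, -, -, h, rfl⟩
  · exact Set.singleton_nonempty P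
  · rw [← Set.one_le_encard_iff_nonempty]
    exact le_trans (by exact_mod_cast hm) h

theorem IsLine.infinite [Infinite K] {Z : Set (Plane K)} (hZ : IsLine Z) : Z.Infinite := by
  obtain ⟨a, -, rfl⟩ := isLine_iff.1 hZ
  exact infinite_zeroSet_linForm a

theorem IsLine.mem_curveFamily [Infinite K] {n m : ℕ} (hn : 0 < n) {Z : Set (Plane K)}
    (hZ : IsLine Z) : Z ∈ curveFamily K n m := by
  have hinf := hZ.infinite
  obtain ⟨f, hf, hf0, rfl⟩ := hZ
  exact Or.inr ⟨f, 1, hn, hf, irreducible_of_isHomogeneous_one hf hf0,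
    by rw [hinf.encard_eq]; exact le_top, rfl⟩

/-- The geometric description of the lines. A curve with more than `n` points which is not a line shares
`n + 1` points with the curve of `exists_curve_through`. -/
theorem isLine_iff_encard_inter_le [Infinite K] {n m : ℕ} (hn : 0 < n) {Z : Set (Plane K)}
    (hZ : Z ∈ curveFamily K n m) :
    IsLine Z ↔ (n : ℕ∞) < Z.encard ∧ ∀ W ∈ curveFamily K n m, W ≠ Z → (Z ∩ W).encard ≤ n := by
  constructor
  · intro h
    refine ⟨by rw [h.infinite.encard_eq]; exact ENat.natCast_lt_top n, fun W hW hne => ?_⟩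
    obtain ⟨a, ha, rfl⟩ := isLine_iff.1 h
    rcases hW with ⟨P, rfl⟩ | ⟨f, d, hd, hf, hfi, -, rfl⟩
    · refine (Set.encard_le_encard Set.inter_subset_right).trans ?_
      rw [Set.encard_singleton]
      exact_mod_cast hn
    · exact (encard_line_inter_zeroSet_le ha hf hfi hne).trans (by exact_mod_cast hd)
  · rintro ⟨hlt, H⟩
    by_contra hline
    rcases hZ with ⟨P, rfl⟩ | ⟨f, d, hd, hf, hfi, -, rfl⟩
    · rw [Set.encard_singleton] at hlt
      have : n < 1 := by exact_mod_cast hlt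
      omega
    · obtain ⟨P, hP, hPf⟩ := le_encard_iff_exists_injective.1
        ((Nat.cast_add_one n).trans_le (Order.add_one_le_of_lt hlt))
      obtain ⟨g, e, he, hg, hgi, hinf, hne, hPg⟩ := exists_curve_through hn hf hfi.ne_zero hline hP
      have h1 := H (zeroSet g) (Or.inr ⟨g, e, he, hg, hgi, by rw [hinf.encard_eq]; exact le_top, rfl⟩) hne
      have h2 := ((le_encard_iff_exists_injective (S := zeroSet f ∩ zeroSet g)).2
        ⟨P, hP, fun i => ⟨hPf i, hPg i⟩⟩).trans h1
      have : n + 1 ≤ n := by exact_mod_cast h2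
      omega

end

section

open FirstOrder FirstOrder.Language

/-! ### Definable sets -/

section Definability
variable {L : Language} {M : Type*} [L.Structure M] {A : Set M} {α β : Type*}

theorem definable_and {p q : (α → M) → Prop} (hp : A.Definable L {x | p x})
    (hq : A.Definable L {x | q x}) : A.Definable L {x | p x ∧ q x} := hp.inter hq

theorem definable_or {p q : (α → M) → Prop} (hp : A.Definable L {x | p x})
    (hq : A.Definable L {x | q x}) : A.Definable L {x | p x ∨ q x} := hp.union hq

theorem definable_not {p : (α → M) → Prop} (hp : A.Definable L {x | p x}) :
    A.Definable L {x | ¬ p x} := hp.compl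

theorem definable_imp {p q : (α → M) → Prop} (hp : A.Definable L {x | p x})
    (hq : A.Definable L {x | q x}) : A.Definable L {x | p x → q x} := by
  simpa only [imp_iff_not_or] using definable_or (definable_not hp) hq

theorem definable_iff {p q : (α → M) → Prop} (hp : A.Definable L {x | p x})
    (hq : A.Definable L {x | q x}) : A.Definable L {x | p x ↔ q x} := by
  simpa only [iff_def] using definable_and (definable_imp hp hq) (definable_imp hq hp)

theorem definable_forall_index {ι : Type*} [Finite ι] {p : ι → (α → M) → Prop}
    (hp : ∀ i, A.Definable L {x | p i x}) : A.Definable L {x | ∀ i, p i x} := by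
  rw [Set.ofPred_forall]
  exact Set.definable_iInter_of_finite hp

theorem definable_exists_index {ι : Type*} [Finite ι] {p : ι → (α → M) → Prop}
    (hp : ∀ i, A.Definable L {x | p i x}) : A.Definable L {x | ∃ i, p i x} := by
  rw [Set.ofPred_exists]
  exact Set.definable_iUnion_of_finite hp

theorem definable_exists_tuple [Finite β] {p : (α → M) → (β → M) → Prop}
    (hp : A.Definable L {w : α ⊕ β → M | p (w ∘ Sum.inl) (w ∘ Sum.inr)}) :
    A.Definable L {x | ∃ y : β → M, p x y} := by
  simpa using hp.exists_of_finite

theorem definable_forall_tuple [Finite β] {p : (α → M) → (β → M) → Prop}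
    (hp : A.Definable L {w : α ⊕ β → M | p (w ∘ Sum.inl) (w ∘ Sum.inr)}) :
    A.Definable L {x | ∀ y : β → M, p x y} := by
  simpa using hp.forall_of_finite

theorem definable_exists {p : (α → M) → M → Prop}
    (hp : A.Definable L {w : α ⊕ Unit → M | p (w ∘ Sum.inl) (w (Sum.inr ()))}) :
    A.Definable L {x | ∃ y, p x y} := by
  have := definable_exists_tuple (p := fun x (y : Unit → M) => p x (y ())) hp
  convert this using 4
  exact ⟨fun ⟨y, hy⟩ => ⟨fun _ => y, hy⟩, fun ⟨y, hy⟩ => ⟨_, hy⟩⟩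

theorem definable_forall {p : (α → M) → M → Prop}
    (hp : A.Definable L {w : α ⊕ Unit → M | p (w ∘ Sum.inl) (w (Sum.inr ()))}) :
    A.Definable L {x | ∀ y, p x y} := by
  have := definable_forall_tuple (p := fun x (y : Unit → M) => p x (y ())) hp
  convert this using 4
  exact ⟨fun h y => h _, fun h y => h fun _ => y⟩

theorem definable_rel₁ {R : M → Prop} (hR : A.Definable L {x : Fin 1 → M | R (x 0)})
    {f : (α → M) → M} (hf : A.DefinableFun L f) : A.Definable L {x | R (f x)} :=
  Set.Definable.preimage_map (F := fun x => ![f x]) (fun i => by fin_cases i; exact hf) hR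

theorem definable_rel₂ {R : M → M → Prop} (hR : A.Definable L {x : Fin 2 → M | R (x 0) (x 1)})
    {f g : (α → M) → M} (hf : A.DefinableFun L f) (hg : A.DefinableFun L g) :
    A.Definable L {x | R (f x) (g x)} :=
  Set.Definable.preimage_map (F := fun x => ![f x, g x])
    (fun i => by fin_cases i; exacts [hf, hg]) hR

theorem definable_rel₃ {R : M → M → M → Prop}
    (hR : A.Definable L {x : Fin 3 → M | R (x 0) (x 1) (x 2)})
    {f g h : (α → M) → M} (hf : A.DefinableFun L f) (hg : A.DefinableFun L g)
    (hh : A.DefinableFun L h) :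
    A.Definable L {x | R (f x) (g x) (h x)} :=
  Set.Definable.preimage_map (F := fun x => ![f x, g x, h x])
    (fun i => by fin_cases i; exacts [hf, hg, hh]) hR

/-- If a structure `N` is embedded by `D` into `M` in such a way that the range of `D` and the images of
the basic functions and relations of `N` are definable, then the images of all definable relations are.
The proof is by induction on formulas, with quantifiers relativized to the range of `D`. -/
theorem definable_image_of_definable {L' : Language} {N : Type*} [L'.Structure N] {D : N → M}
    (hD : Function.Injective D) (hrange : A.Definable L {x : Fin 1 → M | x 0 ∈ Set.range D})
    (hfun : ∀ (k : ℕ) (g : L'.Functions k), A.Definable L {x : Fin (k + 1) → M |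
      ∃ a : Fin k → N, (∀ i, x i.castSucc = D (a i)) ∧ x (Fin.last k) = D (Structure.funMap g a)})
    (hrel : ∀ (k : ℕ) (r : L'.Relations k), A.Definable L {x : Fin k → M |
      ∃ a : Fin k → N, (∀ i, x i = D (a i)) ∧ Structure.RelMap r a})
    [Finite β] {S : Set (β → N)} (hS : (∅ : Set N).Definable L' S) :
    A.Definable L {x : β → M | ∃ a ∈ S, ∀ i, x i = D (a i)} := by
  have hR : ∀ {γ : Type _} (i : γ), A.Definable L {x : γ → M | x i ∈ Set.range D} := fun i =>
    definable_rel₁ (R := (· ∈ Set.range D)) hrange (.proj L)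
  -- the graph of a term
  have hterm : ∀ {γ : Type _} [Finite γ] (t : L'.Term γ), A.Definable L {x : γ ⊕ Unit → M |
      ∃ a : γ → N, (∀ i, x (Sum.inl i) = D (a i)) ∧ x (Sum.inr ()) = D (t.realize a)} := by
    intro γ _ t
    induction t with
    | var i =>
      have := definable_and (definable_forall_index fun j : γ => hR (Sum.inl j : γ ⊕ Unit))
        (Set.DefinableFun.ofPred_eq (L := L) (A := A) (f := fun x : γ ⊕ Unit → M => x (Sum.inr ()))
          (g := fun x => x (Sum.inl i)) (.proj L) (.proj L))
      convert this using 1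
      ext x
      constructor
      · rintro ⟨a, ha, h⟩
        exact ⟨fun j => ⟨a j, (ha j).symm⟩, by rw [h, ha]; rfl⟩
      · rintro ⟨h, h'⟩
        choose a ha using h
        exact ⟨a, fun j => (ha j).symm, by rw [h', ← ha]; rfl⟩
    | @func k g ts ih =>
      have := definable_and (definable_forall_index fun j : γ => hR (Sum.inl j : γ ⊕ Unit))
        (definable_exists_tuple (β := Fin k) (p := fun x y =>
          (∀ i, ∃ a : γ → N, (∀ j, x (Sum.inl j) = D (a j)) ∧ y i = D ((ts i).realize a)) ∧
          ∃ b : Fin k → N, (∀ i, y i = D (b i)) ∧ x (Sum.inr ()) = D (Structure.funMap g b)) <|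
          definable_and
            (definable_forall_index fun i =>
              (ih i).preimage_comp (Sum.elim (Sum.inl ∘ Sum.inl) fun _ => Sum.inr i))
            (by
              have := (hfun k g).preimage_comp (Fin.snoc (fun i => Sum.inr i) (Sum.inl (Sum.inr ())) :
                Fin (k + 1) → (γ ⊕ Unit) ⊕ Fin k)
              simpa [Function.comp_def] using this))
      convert this using 1
      ext x
      constructor
      · rintro ⟨a, ha, h⟩
        exact ⟨fun j => ⟨a j, (ha j).symm⟩, fun i => D ((ts i).realize a),
          fun i => ⟨a, ha, rfl⟩, _, fun i => rfl, h⟩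
      · rintro ⟨h, y, hy, b, hb, hx⟩
        choose a ha using h
        refine ⟨a, fun j => (ha j).symm, ?_⟩
        rw [hx, Term.realize_func]
        congr 2
        ext i
        obtain ⟨a', ha', hy'⟩ := hy i
        have : a' = a := funext fun j => hD (by rw [← ha', ha])
        subst this
        exact hD (by rw [← hb, hy'])
  have hform : ∀ {n : ℕ} (φ : L'.BoundedFormula β n), A.Definable L {x : β ⊕ Fin n → M |
      ∃ a : β ⊕ Fin n → N, (∀ i, x i = D (a i)) ∧ φ.Realize (a ∘ Sum.inl) (a ∘ Sum.inr)} := by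
    intro n φ
    induction φ with
    | falsum => 
      convert Set.definable_empty using 1
      ext x
      simp [BoundedFormula.Realize]
    | @equal n t₁ t₂ =>
      have := definable_exists (p := fun x y =>
        (∃ a : β ⊕ Fin n → N, (∀ i, x i = D (a i)) ∧ y = D (t₁.realize a)) ∧
          ∃ a : β ⊕ Fin n → N, (∀ i, x i = D (a i)) ∧ y = D (t₂.realize a))
        (definable_and (hterm t₁) (hterm t₂))
      convert this using 1
      ext x
      constructor
      · rintro ⟨a, ha, h⟩
        have h : t₁.realize a = t₂.realize a := by simpa [BoundedFormula.Realize] using h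
        exact ⟨D (t₁.realize a), ⟨a, ha, rfl⟩, a, ha, by rw [h]⟩
      · rintro ⟨y, ⟨a, ha, h⟩, a', ha', h'⟩
        obtain rfl : a' = a := funext fun j => hD (by rw [← ha', ha])
        refine ⟨a', ha, ?_⟩
        have := hD (h.symm.trans h')
        simpa [BoundedFormula.Realize] using this
    | @rel n k r ts =>
      have := definable_exists_tuple (β := Fin k) (p := fun (x : β ⊕ Fin n → M) y =>
          (∀ i, ∃ a : β ⊕ Fin n → N, (∀ j, x j = D (a j)) ∧ y i = D ((ts i).realize a)) ∧
          ∃ b : Fin k → N, (∀ i, y i = D (b i)) ∧ Structure.RelMap r b)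
        (definable_and (definable_forall_index fun i =>
            (hterm (ts i)).preimage_comp (Sum.elim Sum.inl fun _ => Sum.inr i))
          ((hrel k r).preimage_comp Sum.inr))
      have := definable_and (definable_forall_index fun j : β ⊕ Fin n => hR j) this
      convert this using 1
      ext x
      constructor
      · rintro ⟨a, ha, h⟩
        refine ⟨fun j => ⟨a j, (ha j).symm⟩, fun i => D ((ts i).realize a), fun i => ⟨a, ha, rfl⟩,
          fun i => (ts i).realize a, fun i => rfl, ?_⟩
        simpa [BoundedFormula.Realize] using h
      · rintro ⟨h, y, hy, b, hb, hr⟩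
        choose a ha using h
        refine ⟨a, fun j => (ha j).symm, ?_⟩
        have : b = fun i => (ts i).realize a := by
          ext i
          obtain ⟨a', ha', hy'⟩ := hy i
          obtain rfl : a' = a := funext fun j => hD (by rw [← ha', ha])
          exact hD (by rw [← hb, hy'])
        rw [this] at hr
        simpa [BoundedFormula.Realize] using hr
    | @imp n φ ψ ih₁ ih₂ =>
      have := definable_and (definable_forall_index fun j : β ⊕ Fin n => hR j)
        (definable_imp ih₁ ih₂)
      convert this using 1
      ext x
      constructor
      · rintro ⟨a, ha, h⟩
        refine ⟨fun j => ⟨a j, (ha j).symm⟩, ?_⟩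
        rintro ⟨a', ha', h'⟩
        obtain rfl : a' = a := funext fun j => hD (by rw [← ha', ha])
        exact ⟨a', ha, h h'⟩
      · rintro ⟨h, himp⟩
        choose a ha using h
        refine ⟨a, fun j => (ha j).symm, fun h' => ?_⟩
        obtain ⟨a', ha', h''⟩ := himp ⟨a, fun j => (ha j).symm, h'⟩
        obtain rfl : a' = a := funext fun j => hD (by rw [← ha', ha])
        exact h''
    | @all n φ ih =>
      have := definable_forall (p := fun (x : β ⊕ Fin n → M) y => y ∈ Set.range D →
          ∃ a : β ⊕ Fin (n + 1) → N, (∀ i, (Sum.elim (fun j => x (Sum.inl j))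
            (Fin.snoc (fun j => x (Sum.inr j)) y : Fin (n + 1) → M) : β ⊕ Fin (n + 1) → M) i
              = D (a i)) ∧ φ.Realize (a ∘ Sum.inl) (a ∘ Sum.inr))
        (definable_imp (hR _) (by
          have := ih.preimage_comp (Sum.elim (fun j => Sum.inl (Sum.inl j))
            (Fin.snoc (fun j => Sum.inl (Sum.inr j)) (Sum.inr ())) :
              β ⊕ Fin (n + 1) → (β ⊕ Fin n) ⊕ Unit)
          convert this using 1
          ext x
          simp [Fin.forall_fin_succ', Sum.forall]))
      have := definable_and (definable_forall_index fun j : β ⊕ Fin n => hR j) this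
      convert this using 1
      ext x
      constructor
      · rintro ⟨a, ha, h⟩
        refine ⟨fun j => ⟨a j, (ha j).symm⟩, ?_⟩
        rintro _ ⟨c, rfl⟩
        refine ⟨Sum.elim (a ∘ Sum.inl) (Fin.snoc (a ∘ Sum.inr) c), ?_, h c⟩
        simp [Fin.forall_fin_succ', Sum.forall, ha]
      · rintro ⟨h, hall⟩
        choose a ha using h
        refine ⟨a, fun j => (ha j).symm, fun c => ?_⟩
        obtain ⟨a', ha', h'⟩ := hall (D c) ⟨c, rfl⟩
        have e1 : a' ∘ Sum.inl = a ∘ Sum.inl := by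
          ext j
          exact hD (by simpa [← ha] using (ha' (Sum.inl j)).symm)
        have e2 : a' ∘ Sum.inr = Fin.snoc (a ∘ Sum.inr) c := by
          ext j
          apply hD
          have := (ha' (Sum.inr j)).symm
          refine Fin.lastCases ?_ (fun j => ?_) j
          · simpa using (ha' (Sum.inr (Fin.last n))).symm
          · simpa [← ha] using (ha' (Sum.inr j.castSucc)).symm
        rw [e1, e2] at h'
        exact h'
  obtain ⟨φ, rfl⟩ := Set.empty_definable_iff.1 hS
  have := (hform φ).preimage_comp (Sum.elim id Fin.elim0 : β ⊕ Fin 0 → β)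
  convert this using 1
  ext x
  constructor
  · rintro ⟨a, ha, hx⟩
    refine ⟨Sum.elim a Fin.elim0, ?_, ?_⟩
    · simp [Sum.forall, hx]
    · convert ha using 1
      simp [Formula.Realize, Subsingleton.elim (_ ∘ Sum.inr) (default : Fin 0 → N)]
  · rintro ⟨a, ha, h⟩
    refine ⟨a ∘ Sum.inl, ?_, ?_⟩
    · rw [Subsingleton.elim (a ∘ Sum.inr) default] at h
      exact h
    · exact fun i => ha (Sum.inl i)

/-- In a finite structure all relations are definable from the elements. -/
theorem definable_of_finite [Finite M] [Finite α] (S : Set (α → M)) :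
    (Set.univ : Set M).Definable L S := by
  have : S = {x | ∃ s : S, ∀ i, x i = s.1 i} := by
    ext x
    exact ⟨fun hx => ⟨⟨x, hx⟩, fun i => rfl⟩, fun ⟨s, hs⟩ => by rw [funext hs]; exact s.2⟩
  rw [this]
  exact definable_exists_index fun s => definable_forall_index fun i =>
    Set.DefinableFun.ofPred_eq_const (.proj L) (Set.mem_univ _)

/-- A finite structure is interpretable in a finite structure with at least two elements, since it
embeds into a power of it. -/
theorem exists_interpretation_of_finite {L : Language} (M : Type*) [L.Structure M] [Finite M]
    [Nontrivial M] {L' : Language} (N : Type*) [L'.Structure N] [Finite N] [Nonempty N] :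
    Nonempty (Interpretation L M Set.univ L' N) := by
  obtain ⟨f⟩ : Nonempty (N ↪ (Fin (Nat.card N) → M)) := by
    have := Fintype.ofFinite M
    have := Fintype.ofFinite N
    apply Function.Embedding.nonempty_of_card_le
    rw [Fintype.card_fun, Fintype.card_fin, Nat.card_eq_fintype_card]
    exact (Nat.lt_pow_self Fintype.one_lt_card).le
  exact ⟨{
    dim := Nat.card N
    dom := Set.univ
    map := Function.invFun f
    surj := fun y _ => ⟨f y, trivial, Function.leftInverse_invFun f.injective y⟩
    definable_dom := definable_of_finite _
    definable_eq := definable_of_finite _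
    definable_fun := fun _ _ => definable_of_finite _
    definable_rel := fun _ _ => definable_of_finite _ }⟩

theorem biInterpretable_of_finite {L : Language} (M : Type*) [L.Structure M] [Finite M]
    [Nontrivial M] {L' : Language} (N : Type*) [L'.Structure N] [Finite N] [Nontrivial N] :
    BiInterpretable L M Set.univ L' N Set.univ := by
  obtain ⟨I⟩ := exists_interpretation_of_finite (L := L) (L' := L') M N
  obtain ⟨J⟩ := exists_interpretation_of_finite (L := L') (L' := L) N M
  exact ⟨I, J, definable_of_finite _, definable_of_finite _⟩

end Definability

end

section

open FirstOrder FirstOrder.Language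

variable {K : Type*} [Field K]

/-! ### Points and lines in the poset -/

theorem definable_le {V : Set (Set (Plane K))} {A : Set V} :
    A.Definable Language.order {x : Fin 2 → V | x 0 ≤ x 1} := by
  refine Set.Definable.mono (A := ∅) (Set.empty_definable_iff.2
    ⟨(leSymb : Language.order.Relations 2).formula₂ (Term.var 0) (Term.var 1), ?_⟩) (Set.empty_subset A)
  ext x
  simp [Formula.realize_rel₂]
  rfl

/-- A family of nonempty subsets of the plane in which the projective plane can be recognized: points
and lines belong to it, and the lines are definable without parameters. (The points are definable, being
the minimal elements.) -/
structure IsPlaneFamily (V : Set (Set (Plane K))) : Prop where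
  singleton_mem : ∀ P, {P} ∈ V
  nonempty : ∀ Z ∈ V, Z.Nonempty
  line_mem : ∀ Z, IsLine Z → Z ∈ V
  definable_isLine : (∅ : Set V).Definable₁ Language.order {x : V | IsLine (x : Set (Plane K))}

/-- `x` is a point, as a one-element set. -/
def IsPt {V : Set (Set (Plane K))} (x : V) : Prop := ∃ P, (x : Set (Plane K)) = {P}

theorem isPt_iff_forall_le {V : Set (Set (Plane K))} (hs : ∀ P, {P} ∈ V)
    (hne : ∀ Z ∈ V, Z.Nonempty) (x : V) : IsPt x ↔ ∀ y, y ≤ x → y = x := by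
  constructor
  · rintro ⟨P, hP⟩ y hy
    apply Subtype.ext
    have hy : (y : Set (Plane K)) ⊆ x := hy
    rw [hP] at hy ⊢
    exact ((hne y y.2).subset_singleton_iff).1 hy
  · intro h
    obtain ⟨P, hP⟩ := hne x x.2
    exact ⟨P, by rw [← h ⟨{P}, hs P⟩ (Set.singleton_subset_iff.2 hP)]⟩

theorem definable_isPt {V : Set (Set (Plane K))} {A : Set V} (hs : ∀ P, {P} ∈ V)
    (hne : ∀ Z ∈ V, Z.Nonempty) : A.Definable Language.order {x : Fin 1 → V | IsPt (x 0)} := by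
  simp only [isPt_iff_forall_le hs hne]
  refine definable_forall (definable_imp (definable_rel₂ definable_le (.proj _) (.proj _)) ?_)
  exact Set.DefinableFun.ofPred_eq (.proj _) (.proj _)

theorem lt_encard_iff {V : Set (Set (Plane K))} (hs : ∀ P, {P} ∈ V) (n : ℕ) (S : Set (Plane K)) :
    (n : ℕ∞) < S.encard ↔ ∃ y : Fin (n + 1) → V, (∀ i, IsPt (y i) ∧ (y i : Set (Plane K)) ⊆ S) ∧
      ∀ i j, i ≠ j → y i ≠ y j := by
  rw [← ENat.add_one_le_iff (ENat.natCast_ne_top n), ← Nat.cast_add_one, le_encard_iff_exists_injective]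
  constructor
  · rintro ⟨P, hP, hPS⟩
    refine ⟨fun i => ⟨{P i}, hs _⟩, fun i => ⟨⟨_, rfl⟩, Set.singleton_subset_iff.2 (hPS i)⟩,
      fun i j hij h => hij (hP (Set.singleton_injective (congrArg Subtype.val h)))⟩
  · rintro ⟨y, hy, hinj⟩
    choose P hP using fun i => (hy i).1
    refine ⟨P, fun i j h => ?_, fun i => Set.singleton_subset_iff.1 (hP i ▸ (hy i).2)⟩
    by_contra hij
    exact hinj i j hij (Subtype.ext (by rw [hP, hP, h]))

theorem definable_lt_encard_inter {V : Set (Set (Plane K))} (hs : ∀ P, {P} ∈ V)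
    (hne : ∀ Z ∈ V, Z.Nonempty) (n : ℕ) : (∅ : Set V).Definable Language.order
      {x : Fin 2 → V | (n : ℕ∞) < ((x 0 : Set (Plane K)) ∩ x 1).encard} := by
  simp only [lt_encard_iff hs, Set.subset_inter_iff]
  refine definable_exists_tuple (definable_and (definable_forall_index fun i =>
    definable_and (definable_rel₁ (definable_isPt hs hne) (.proj _)) (definable_and ?_ ?_))
    (definable_forall_index fun i => definable_forall_index fun j => ?_))
  · exact definable_rel₂ (R := fun x y : V => x ≤ y) definable_le (.proj _) (.proj _)
  · exact definable_rel₂ (R := fun x y : V => x ≤ y) definable_le (.proj _) (.proj _)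
  · by_cases hij : i = j
    · simp [hij]
    · simp only [ne_eq, hij, not_false_eq_true, true_imp_iff]
      exact definable_not (Set.DefinableFun.ofPred_eq (.proj _) (.proj _))

/-- The lines are definable by their description in `isLine_iff_encard_inter_le`. -/
theorem isPlaneFamily_curveFamily [Infinite K] {n m : ℕ} (hn : 0 < n) (hm : 0 < m) :
    IsPlaneFamily (curveFamily K n m) := by
  have hs : ∀ P, {P} ∈ curveFamily K n m := singleton_mem_curveFamily
  have hne : ∀ Z ∈ curveFamily K n m, Z.Nonempty := fun Z => nonempty_of_mem_curveFamily hm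
  refine ⟨hs, hne, fun Z hZ => hZ.mem_curveFamily hn, ?_⟩
  have : {x : curveFamily K n m | IsLine (x : Set (Plane K))} =
      {x : curveFamily K n m | (n : ℕ∞) < ((x : Set (Plane K)) ∩ x).encard ∧
        ∀ y : curveFamily K n m, ¬ (y = x) → ¬ (n : ℕ∞) < ((x : Set (Plane K)) ∩ y).encard} := by
    ext x
    simp only [Set.mem_ofPred_eq, isLine_iff_encard_inter_le hn x.2, Set.inter_self, not_lt,
      Subtype.forall, Subtype.ext_iff]
  rw [this]
  have hd := definable_lt_encard_inter hs hne n
  refine definable_and (definable_rel₂ (R := fun x y : curveFamily K n m =>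
    (n : ℕ∞) < ((x : Set (Plane K)) ∩ y).encard) hd (.proj _) (.proj _)) (definable_forall
    (definable_imp (definable_not (Set.DefinableFun.ofPred_eq (.proj _) (.proj _)))
      (definable_not (definable_rel₂ (R := fun x y : curveFamily K n m =>
    (n : ℕ∞) < ((x : Set (Plane K)) ∩ y).encard) hd (.proj _) (.proj _)))))

/-! ### Coordinates in the poset -/

section Coordinates
variable {V : Set (Set (Plane K))}

/-! Coordinates are introduced with respect to a frame `c`, whose points are thought of as the origin
`c 0`, the points at infinity `c 1` and `c 2` of the two axes, and the unit point `c 3 = (1, 1)`. A scalar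
`a` is represented by the affine point `(a, a)` of the diagonal. -/

/-- The points `x`, `y`, `z` are collinear. -/
def Coll (x y z : V) : Prop :=
  ∃ l : V, IsLine (l : Set (Plane K)) ∧ x ≤ l ∧ y ≤ l ∧ z ≤ l

/-- `x` is on the diagonal line through `c 0`, `c 3`, and not on the line at infinity. -/
def OnDiag (c : Fin 4 → V) (x : V) : Prop :=
  IsPt x ∧ Coll x (c 0) (c 3) ∧ ¬ Coll x (c 1) (c 2)

/-- `p` is the affine point whose coordinates are represented by the diagonal points `x`, `y`. -/
def HasCoords (c : Fin 4 → V) (x y p : V) : Prop :=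
  IsPt p ∧ Coll x p (c 2) ∧ Coll y p (c 1)

/-- `p` is the point at infinity of the lines whose slope is represented by `y`. -/
def IsSlope (c : Fin 4 → V) (y p : V) : Prop :=
  IsPt p ∧ Coll p (c 1) (c 2) ∧ ∃ q, HasCoords c (c 3) y q ∧ Coll p (c 0) q

/-- `x * y = z` for the scalars represented by diagonal points: the origin, `(1, y)` and `(x, z)` are
collinear. -/
def MulRel (c : Fin 4 → V) (x y z : V) : Prop :=
  ∃ p q, HasCoords c (c 3) y p ∧ HasCoords c x z q ∧ Coll (c 0) p q

/-- `x + y = z` for the scalars represented by diagonal points: the line through `(0, y)` and `(x, z)`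
has slope one. -/
def AddRel (c : Fin 4 → V) (x y z : V) : Prop :=
  ∃ p q u, HasCoords c (c 0) y p ∧ HasCoords c x z q ∧ IsSlope c (c 3) u ∧ Coll p q u

/-- `(x : y : z)` are the homogeneous coordinates of `p`, normalized such that the first nonzero one is
one. -/
def HomCoords (c : Fin 4 → V) (x y z p : V) : Prop :=
  (x = c 3 ∧ HasCoords c y z p) ∨ (x = c 0 ∧ y = c 3 ∧ IsSlope c z p) ∨
    (x = c 0 ∧ y = c 0 ∧ z = c 3 ∧ p = c 2)

variable {A : Set V} {c : Fin 4 → V}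

theorem definable_coll (hV : IsPlaneFamily V) :
    A.Definable Language.order {x : Fin 3 → V | Coll (x 0) (x 1) (x 2)} := by
  have hl : A.Definable Language.order {x : Fin 1 → V | IsLine (x 0 : Set (Plane K))} :=
    Set.Definable.mono (A := ∅) hV.definable_isLine (Set.empty_subset A)
  have hle := definable_le (V := V) (A := A)
  refine definable_exists (definable_and (definable_rel₁ (R := fun l : V => IsLine (l : Set (Plane K)))
    hl (.proj _)) (definable_and ?_ (definable_and ?_ ?_))) <;>
  exact definable_rel₂ hle (.proj _) (.proj _)

theorem definable_hasCoords (hV : IsPlaneFamily V) (hc : ∀ i, c i ∈ A) :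
    A.Definable Language.order {x : Fin 3 → V | HasCoords c (x 0) (x 1) (x 2)} := by
  have hp := definable_isPt (A := A) hV.singleton_mem hV.nonempty
  have hk := definable_coll (A := A) hV
  have hcf := fun i (α : Type) => definableFun_const (L := Language.order) α (hc i)
  exact definable_and (definable_rel₁ hp (.proj _)) (definable_and
    (definable_rel₃ hk (.proj _) (.proj _) (hcf _ _)) (definable_rel₃ hk (.proj _) (.proj _) (hcf _ _)))

theorem definable_onDiag (hV : IsPlaneFamily V) (hc : ∀ i, c i ∈ A) :
    A.Definable Language.order {x : Fin 1 → V | OnDiag c (x 0)} := by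
  have hp := definable_isPt (A := A) hV.singleton_mem hV.nonempty
  have hk := definable_coll (A := A) hV
  have hcf := fun i (α : Type) => definableFun_const (L := Language.order) α (hc i)
  exact definable_and (definable_rel₁ hp (.proj _)) (definable_and
    (definable_rel₃ hk (.proj _) (hcf _ _) (hcf _ _))
    (definable_not (definable_rel₃ hk (.proj _) (hcf _ _) (hcf _ _))))

theorem definable_isSlope (hV : IsPlaneFamily V) (hc : ∀ i, c i ∈ A) :
    A.Definable Language.order {x : Fin 2 → V | IsSlope c (x 0) (x 1)} := by
  have hp := definable_isPt (A := A) hV.singleton_mem hV.nonempty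
  have hk := definable_coll (A := A) hV
  have hh := definable_hasCoords hV hc
  have hcf := fun i (α : Type) => definableFun_const (L := Language.order) α (hc i)
  exact definable_and (definable_rel₁ hp (.proj _)) (definable_and
    (definable_rel₃ hk (.proj _) (hcf _ _) (hcf _ _))
    (definable_exists (definable_and (definable_rel₃ hh (hcf _ _) (.proj _) (.proj _))
      (definable_rel₃ hk (.proj _) (hcf _ _) (.proj _)))))

theorem definable_mulRel (hV : IsPlaneFamily V) (hc : ∀ i, c i ∈ A) :
    A.Definable Language.order {x : Fin 3 → V | MulRel c (x 0) (x 1) (x 2)} := by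
  have hk := definable_coll (A := A) hV
  have hh := definable_hasCoords hV hc
  have hcf := fun i (α : Type) => definableFun_const (L := Language.order) α (hc i)
  exact definable_exists (definable_exists (definable_and
    (definable_rel₃ hh (hcf _ _) (.proj _) (.proj _))
    (definable_and (definable_rel₃ hh (.proj _) (.proj _) (.proj _))
      (definable_rel₃ hk (hcf _ _) (.proj _) (.proj _)))))

theorem definable_addRel (hV : IsPlaneFamily V) (hc : ∀ i, c i ∈ A) :
    A.Definable Language.order {x : Fin 3 → V | AddRel c (x 0) (x 1) (x 2)} := by
  have hk := definable_coll (A := A) hV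
  have hh := definable_hasCoords hV hc
  have hs := definable_isSlope hV hc
  have hcf := fun i (α : Type) => definableFun_const (L := Language.order) α (hc i)
  exact definable_exists (definable_exists (definable_exists (definable_and
    (definable_rel₃ hh (hcf _ _) (.proj _) (.proj _))
    (definable_and (definable_rel₃ hh (.proj _) (.proj _) (.proj _))
      (definable_and (definable_rel₂ hs (hcf _ _) (.proj _))
        (definable_rel₃ hk (.proj _) (.proj _) (.proj _)))))))

theorem definable_homCoords (hV : IsPlaneFamily V) (hc : ∀ i, c i ∈ A) :
    A.Definable Language.order {x : Fin 4 → V | HomCoords c (x 0) (x 1) (x 2) (x 3)} := by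
  have hh := definable_hasCoords hV hc
  have hs := definable_isSlope hV hc
  have hcf := fun i (α : Type) => definableFun_const (L := Language.order) α (hc i)
  have heq : ∀ i j, A.Definable Language.order {x : Fin 4 → V | x i = c j} := fun i j =>
    Set.DefinableFun.ofPred_eq (.proj _) (hcf _ _)
  exact definable_or (definable_and (heq _ _) (definable_rel₃ hh (.proj _) (.proj _) (.proj _)))
    (definable_or (definable_and (heq _ _) (definable_and (heq _ _)
      (definable_rel₂ hs (.proj _) (.proj _))))
      (definable_and (heq _ _) (definable_and (heq _ _) (definable_and (heq _ _) (heq _ _)))))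

/-! ### Evaluation in coordinates -/

/-- The point with homogeneous coordinates `x` in the frame given by `T`. -/
noncomputable def vpt (hV : IsPlaneFamily V) (T : (Fin 3 → K) ≃ₗ[K] (Fin 3 → K)) (x : Fin 3 → K) : V :=
  ⟨{pt (T x)}, hV.singleton_mem _⟩

variable (hV : IsPlaneFamily V) (T : (Fin 3 → K) ≃ₗ[K] (Fin 3 → K))

theorem isPt_iff {x : V} : IsPt x ↔ ∃ v, v ≠ 0 ∧ x = vpt hV T v := by
  constructor
  · rintro ⟨P, hP⟩
    obtain ⟨y, hy, rfl⟩ := exists_pt P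
    refine ⟨T.symm y, (map_ne_zero_iff _ T.symm.injective).2 hy, Subtype.ext ?_⟩
    simp [hP, vpt]
  · rintro ⟨v, -, rfl⟩
    exact ⟨_, rfl⟩

theorem vpt_eq_vpt {x y : Fin 3 → K} (hx : x ≠ 0) (hy : y ≠ 0) :
    vpt hV T x = vpt hV T y ↔ ∃ c : K, c • y = x := by
  rw [vpt, vpt, Subtype.mk.injEq, Set.singleton_eq_singleton_iff,
    pt_eq_pt ((map_ne_zero_iff _ T.injective).2 hx) ((map_ne_zero_iff _ T.injective).2 hy)]
  simp only [← map_smul, T.injective.eq_iff]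

theorem vpt_le_iff {x : Fin 3 → K} {Z : V} : vpt hV T x ≤ Z ↔ pt (T x) ∈ (Z : Set (Plane K)) :=
  Set.singleton_subset_iff

theorem coll_vpt {x y z : Fin 3 → K} (hx : x ≠ 0) (hy : y ≠ 0) (hz : z ≠ 0) :
    Coll (vpt hV T x) (vpt hV T y) (vpt hV T z) ↔ (Matrix.of ![x, y, z]).det = 0 := by
  have h0 : ∀ {x}, x ≠ 0 → T x ≠ 0 := fun h => (map_ne_zero_iff _ T.injective).2 h
  have h1 : (Matrix.of ![x, y, z]).det = 0 ↔ (Matrix.of ![T x, T y, T z]).det = 0 := by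
    rw [← Matrix.exists_vecMul_eq_zero_iff, ← Matrix.exists_vecMul_eq_zero_iff]
    refine exists_congr fun c => and_congr_right fun _ => ?_
    rw [Matrix.vecMul_eq_sum, Matrix.vecMul_eq_sum, Fin.sum_univ_three, Fin.sum_univ_three]
    rw [← map_eq_zero_iff T T.injective, map_add, map_add, map_smul, map_smul, map_smul]
    rfl
  rw [h1, ← exists_dotProduct_iff_exists_combination]
  constructor
  · rintro ⟨l, hl, hxl, hyl, hzl⟩
    obtain ⟨a, ha, hla⟩ := isLine_iff.1 hl
    rw [vpt_le_iff, hla, pt_mem_zeroSet (linForm_isHomogeneous a) (h0 ‹_›), eval_linForm] at hxl hyl hzl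
    exact ⟨a, ha, hxl, hyl, hzl⟩
  · rintro ⟨a, ha, hxa, hya, hza⟩
    have hl : IsLine (zeroSet (linForm a)) := isLine_iff.2 ⟨a, ha, rfl⟩
    refine ⟨⟨_, hV.line_mem _ hl⟩, hl, ?_, ?_, ?_⟩ <;>
    rw [vpt_le_iff, pt_mem_zeroSet (linForm_isHomogeneous a) (h0 ‹_›), eval_linForm] <;> assumption

/-- The standard frame `(1 : 0 : 0), (0 : 1 : 0), (0 : 0 : 1), (1 : 1 : 1)` in the coordinates given
by `T`. -/
noncomputable def frame (i : Fin 4) : V :=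
  vpt hV T (![![1, 0, 0], ![0, 1, 0], ![0, 0, 1], ![1, 1, 1] ] i)

/-- The affine point `(a, a)`, which represents the scalar `a`. -/
noncomputable def diagPt (a : K) : V := vpt hV T ![1, a, a]

theorem diagPt_injective : Function.Injective (diagPt hV T) := by
  intro a b h
  obtain ⟨c, hc⟩ := (vpt_eq_vpt hV T (by simp) (by simp)).1 h
  have h0 := congrFun hc 0
  have h1 := congrFun hc 1
  simp at h0 h1
  simpa [h0] using h1.symm

theorem frame_zero : frame hV T 0 = diagPt hV T 0 := rfl
theorem frame_one : frame hV T 1 = vpt hV T ![0, 1, 0] := rfl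
theorem frame_two : frame hV T 2 = vpt hV T ![0, 0, 1] := rfl
theorem frame_three : frame hV T 3 = diagPt hV T 1 := rfl

theorem onDiag_iff {x : V} : OnDiag (frame hV T) x ↔ ∃ a, x = diagPt hV T a := by
  constructor
  · rintro ⟨hx, h1, h2⟩
    obtain ⟨v, hv, rfl⟩ := (isPt_iff hV T).1 hx
    simp only [frame_zero, frame_one, frame_two, frame_three, diagPt] at h1 h2
    rw [coll_vpt hV T hv (by simp) (by simp), Matrix.det_fin_three] at h1 h2
    simp at h1 h2
    refine ⟨v 1 / v 0, (vpt_eq_vpt hV T hv (by simp)).2 ⟨v 0, ?_⟩⟩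
    ext i; fin_cases i <;> simp <;> field_simp
    linear_combination -h1
  · rintro ⟨a, rfl⟩
    refine ⟨⟨_, rfl⟩, ?_, ?_⟩
    · simp only [frame_zero, frame_three, diagPt]
      rw [coll_vpt hV T (by simp) (by simp) (by simp), Matrix.det_fin_three]
      simp
    · simp only [frame_one, frame_two, diagPt]
      rw [coll_vpt hV T (by simp) (by simp) (by simp), Matrix.det_fin_three]
      simp

theorem hasCoords_iff {a b : K} {p : V} :
    HasCoords (frame hV T) (diagPt hV T a) (diagPt hV T b) p ↔ p = vpt hV T ![1, a, b] := by
  constructor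
  · rintro ⟨hp, h1, h2⟩
    obtain ⟨v, hv, rfl⟩ := (isPt_iff hV T).1 hp
    rw [frame_two, diagPt, coll_vpt hV T (by simp) hv (by simp), Matrix.det_fin_three] at h1
    rw [frame_one, diagPt, coll_vpt hV T (by simp) hv (by simp), Matrix.det_fin_three] at h2
    simp at h1 h2
    have h1 : v 1 = a * v 0 := by linear_combination h1
    have h2 : v 2 = b * v 0 := by linear_combination -h2
    refine (vpt_eq_vpt hV T hv (by simp)).2 ⟨v 0, ?_⟩
    ext i; fin_cases i <;> simp [h1, h2, mul_comm]
  · rintro rfl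
    refine ⟨⟨_, rfl⟩, ?_, ?_⟩ <;>
    · simp only [frame_one, frame_two, diagPt]
      rw [coll_vpt hV T (by simp) (by simp) (by simp), Matrix.det_fin_three]
      simp

theorem isSlope_iff {b : K} {p : V} :
    IsSlope (frame hV T) (diagPt hV T b) p ↔ p = vpt hV T ![0, 1, b] := by
  simp only [IsSlope, frame_three, hasCoords_iff, exists_eq_left]
  constructor
  · rintro ⟨hp, h1, h2⟩
    obtain ⟨v, hv, rfl⟩ := (isPt_iff hV T).1 hp
    rw [frame_zero, diagPt, coll_vpt hV T hv (by simp) (by simp), Matrix.det_fin_three] at h2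
    rw [frame_one, frame_two, coll_vpt hV T hv (by simp) (by simp), Matrix.det_fin_three] at h1
    simp at h1 h2
    refine (vpt_eq_vpt hV T hv (by simp)).2 ⟨v 1, ?_⟩
    ext i; fin_cases i <;> simp [h1]
    linear_combination -h2
  · rintro rfl
    refine ⟨⟨_, rfl⟩, ?_, ?_⟩
    · rw [frame_one, frame_two, coll_vpt hV T (by simp) (by simp) (by simp), Matrix.det_fin_three]
      simp
    · rw [frame_zero, diagPt, coll_vpt hV T (by simp) (by simp) (by simp), Matrix.det_fin_three]
      simp

theorem mulRel_iff {a b c : K} :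
    MulRel (frame hV T) (diagPt hV T a) (diagPt hV T b) (diagPt hV T c) ↔ a * b = c := by
  simp only [MulRel, frame_three, hasCoords_iff, exists_eq_left, exists_and_left]
  rw [frame_zero, diagPt, coll_vpt hV T (by simp) (by simp) (by simp), Matrix.det_fin_three]
  simp [sub_eq_zero, eq_comm, mul_comm]

theorem addRel_iff {a b c : K} :
    AddRel (frame hV T) (diagPt hV T a) (diagPt hV T b) (diagPt hV T c) ↔ a + b = c := by
  simp only [AddRel, frame_three, frame_zero, isSlope_iff, hasCoords_iff, exists_eq_left, exists_and_left]
  rw [coll_vpt hV T (by simp) (by simp) (by simp), Matrix.det_fin_three]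
  simp
  rw [← sub_eq_zero (a := a + b), add_sub_right_comm]

theorem homCoords_diagPt {z : Fin 3 → K} {p : V}
    (h : HomCoords (frame hV T) (diagPt hV T (z 0)) (diagPt hV T (z 1)) (diagPt hV T (z 2)) p) :
    z ≠ 0 ∧ p = vpt hV T z := by
  have hz : z = ![z 0, z 1, z 2] := by ext i; fin_cases i <;> rfl
  simp only [HomCoords, frame_three, frame_zero, isSlope_iff, hasCoords_iff,
    (diagPt_injective hV T).eq_iff] at h
  rcases h with ⟨h0, h⟩ | ⟨h0, h1, h⟩ | ⟨h0, h1, h2, h⟩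
  · rw [hz, h0]
    exact ⟨by simp, h⟩
  · rw [hz, h0, h1]
    exact ⟨by simp, h⟩
  · rw [hz, h0, h1, h2]
    exact ⟨by simp, h⟩

theorem exists_homCoords {p : V} (hp : IsPt p) : ∃ z : Fin 3 → K,
    HomCoords (frame hV T) (diagPt hV T (z 0)) (diagPt hV T (z 1)) (diagPt hV T (z 2)) p := by
  obtain ⟨v, hv, rfl⟩ := (isPt_iff hV T).1 hp
  simp only [HomCoords, frame_three, frame_zero, isSlope_iff, hasCoords_iff,
    (diagPt_injective hV T).eq_iff]
  by_cases h0 : v 0 = 0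
  · by_cases h1 : v 1 = 0
    · refine ⟨![0, 0, 1], Or.inr (Or.inr ⟨rfl, rfl, rfl, (vpt_eq_vpt hV T hv (by simp)).2 ⟨v 2, ?_⟩⟩)⟩
      ext i; fin_cases i <;> simp [h0, h1]
    · refine ⟨![0, 1, v 2 / v 1], Or.inr (Or.inl ⟨rfl, rfl, (vpt_eq_vpt hV T hv (by simp)).2 ⟨v 1, ?_⟩⟩)⟩
      ext i; fin_cases i <;> simp [h0]; field_simp
  · refine ⟨![1, v 1 / v 0, v 2 / v 0], Or.inl ⟨rfl, (vpt_eq_vpt hV T hv (by simp)).2 ⟨v 0, ?_⟩⟩⟩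
    ext i; fin_cases i <;> simp <;> field_simp

theorem definable_range_diagPt (hA : ∀ i, frame hV T i ∈ A) :
    A.Definable Language.order {x : Fin 1 → V | x 0 ∈ Set.range (diagPt hV T)} := by
  have h : ∀ x, x ∈ Set.range (diagPt hV T) ↔ OnDiag (frame hV T) x := fun x => by
    rw [onDiag_iff]
    exact exists_congr fun _ => eq_comm
  simp only [h]
  exact definable_onDiag hV hA

/-- The order is determined by the incidence with points given by coordinates. -/
theorem le_iff_forall_vpt {X Y : V} :
    X ≤ Y ↔ ∀ z, z ≠ 0 ∧ vpt hV T z ≤ X → z ≠ 0 ∧ vpt hV T z ≤ Y := by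
  constructor
  · exact fun h z hz => ⟨hz.1, hz.2.trans h⟩
  · intro h P hP
    obtain ⟨v, hv, hvP⟩ := (isPt_iff hV T (x := ⟨{P}, hV.singleton_mem P⟩)).1 ⟨P, rfl⟩
    have h1 : vpt hV T v ≤ X := by rw [← hvP]; exact Set.singleton_subset_iff.2 hP
    have h2 := (h v ⟨hv, h1⟩).2
    rw [← hvP] at h2
    exact Set.singleton_subset_iff.1 h2

theorem eq_iff_forall_vpt {X Y : V} :
    X = Y ↔ ∀ z, z ≠ 0 ∧ vpt hV T z ≤ X ↔ z ≠ 0 ∧ vpt hV T z ≤ Y := by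
  rw [le_antisymm_iff, le_iff_forall_vpt hV T, le_iff_forall_vpt hV T]
  simp only [iff_def, forall_and]

end Coordinates

end

section

open FirstOrder FirstOrder.Language

variable {K : Type*} [Field K] [FirstOrder.Ring.CompatibleRing K]

/-! ### The field inside the poset -/

theorem definableFun_mul {α : Type*} {f g : (α → K) → K}
    (hf : (∅ : Set K).DefinableFun Language.ring f) (hg : (∅ : Set K).DefinableFun Language.ring g) :
    (∅ : Set K).DefinableFun Language.ring fun x => f x * g x := by
  have h : (∅ : Set K).DefinableFun Language.ring fun v : Fin 2 → K => v 0 * v 1 := by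
    convert Term.definableFun_realize (M := K) (Term.var 0 * Term.var 1 : Language.ring.Term (Fin 2)) using 2
    simp
  exact Set.DefinableFun.comp (g := fun x => ![f x, g x])
    (fun i => by fin_cases i; exacts [hf, hg]) h

theorem definableFun_add {α : Type*} {f g : (α → K) → K}
    (hf : (∅ : Set K).DefinableFun Language.ring f) (hg : (∅ : Set K).DefinableFun Language.ring g) :
    (∅ : Set K).DefinableFun Language.ring fun x => f x + g x := by
  have h : (∅ : Set K).DefinableFun Language.ring fun v : Fin 2 → K => v 0 + v 1 := by
    convert Term.definableFun_realize (M := K) (Term.var 0 + Term.var 1 : Language.ring.Term (Fin 2)) using 2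
    simp
  exact Set.DefinableFun.comp (g := fun x => ![f x, g x])
    (fun i => by fin_cases i; exacts [hf, hg]) h

theorem definableFun_zero {α : Type*} :
    (∅ : Set K).DefinableFun Language.ring fun _ : α → K => (0 : K) := by
  convert Term.definableFun_realize (M := K) (0 : Language.ring.Term α) using 2
  simp

theorem definableFun_one {α : Type*} :
    (∅ : Set K).DefinableFun Language.ring fun _ : α → K => (1 : K) := by
  convert Term.definableFun_realize (M := K) (1 : Language.ring.Term α) using 2
  simp

theorem definableFun_pow {α : Type*} {f : (α → K) → K}
    (hf : (∅ : Set K).DefinableFun Language.ring f) (n : ℕ) :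
    (∅ : Set K).DefinableFun Language.ring fun x => f x ^ n := by
  induction n with
  | zero => simpa using definableFun_one
  | succ n ih => simpa only [pow_succ] using definableFun_mul ih hf

theorem definableFun_sum {α ι : Type*} (s : Finset ι) {f : ι → (α → K) → K}
    (hf : ∀ i ∈ s, (∅ : Set K).DefinableFun Language.ring (f i)) :
    (∅ : Set K).DefinableFun Language.ring fun x => ∑ i ∈ s, f i x := by
  classical
  induction s using Finset.induction_on with
  | empty => simpa using definableFun_zero
  | insert i s hi ih =>
    simp only [Finset.sum_insert hi]
    exact definableFun_add (hf i (Finset.mem_insert_self _ _))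
      (ih fun j hj => hf j (Finset.mem_insert_of_mem hj))

theorem definable_ne_zero {α : Type*} {f : (α → K) → K}
    (hf : (∅ : Set K).DefinableFun Language.ring f) :
    (∅ : Set K).Definable Language.ring {x | f x ≠ 0} :=
  definable_not (hf.ofPred_eq definableFun_zero)

section
variable {V : Set (Set (Plane K))} (hV : IsPlaneFamily V) (T : (Fin 3 → K) ≃ₗ[K] (Fin 3 → K))
  {A : Set V}

/-- The ring operations on the points of the diagonal are definable from the frame. -/
theorem definable_ring_graph (hA : ∀ i, frame hV T i ∈ A) (k : ℕ) (g : Language.ring.Functions k) :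
    A.Definable Language.order {x : Fin (k + 1) → V | ∃ a : Fin k → K,
      (∀ i, x i.castSucc = diagPt hV T (a i)) ∧
        x (Fin.last k) = diagPt hV T (Structure.funMap g a)} := by
  have hr : ∀ {k} (i : Fin k), A.Definable Language.order
      {x : Fin k → V | x i ∈ Set.range (diagPt hV T)} := fun i =>
    definable_rel₁ (R := (· ∈ Set.range (diagPt hV T))) (definable_range_diagPt hV T hA) (.proj _)
  have hcf := fun i (α : Type) => definableFun_const (L := Language.order) α (hA i)
  cases g with
  | add =>
    convert definable_and (definable_and (hr (0 : Fin 3)) (definable_and (hr 1) (hr 2)))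
      (definable_addRel hV hA) using 1
    ext x
    constructor
    · rintro ⟨a, ha, h⟩
      have h0 : x 0 = _ := ha 0
      have h1 : x 1 = _ := ha 1
      have h2 : x 2 = _ := h
      refine ⟨⟨⟨_, h0.symm⟩, ⟨_, h1.symm⟩, ⟨_, h2.symm⟩⟩, ?_⟩
      rw [h0, h1, h2, addRel_iff]
      exact (Ring.CompatibleRing.funMap_add a).symm
    · rintro ⟨⟨⟨a, h0⟩, ⟨b, h1⟩, ⟨c, h2⟩⟩, h⟩
      rw [← h0, ← h1, ← h2, addRel_iff] at h
      refine ⟨![a, b], fun i => ?_, ?_⟩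
      · fin_cases i; exacts [h0.symm, h1.symm]
      · exact h2.symm.trans (congrArg _ (h.symm.trans (Ring.CompatibleRing.funMap_add ![a, b]).symm))
  | mul =>
    convert definable_and (definable_and (hr (0 : Fin 3)) (definable_and (hr 1) (hr 2)))
      (definable_mulRel hV hA) using 1
    ext x
    constructor
    · rintro ⟨a, ha, h⟩
      have h0 : x 0 = _ := ha 0
      have h1 : x 1 = _ := ha 1
      have h2 : x 2 = _ := h
      refine ⟨⟨⟨_, h0.symm⟩, ⟨_, h1.symm⟩, ⟨_, h2.symm⟩⟩, ?_⟩
      rw [h0, h1, h2, mulRel_iff]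
      exact (Ring.CompatibleRing.funMap_mul a).symm
    · rintro ⟨⟨⟨a, h0⟩, ⟨b, h1⟩, ⟨c, h2⟩⟩, h⟩
      rw [← h0, ← h1, ← h2, mulRel_iff] at h
      refine ⟨![a, b], fun i => ?_, ?_⟩
      · fin_cases i; exacts [h0.symm, h1.symm]
      · exact h2.symm.trans (congrArg _ (h.symm.trans (Ring.CompatibleRing.funMap_mul ![a, b]).symm))
  | neg =>
    convert definable_and (definable_and (hr (0 : Fin 2)) (hr 1))
      (definable_rel₃ (definable_addRel hV hA) (.proj _ (i := 0)) (.proj _ (i := 1)) (hcf 0 _)) using 1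
    ext x
    constructor
    · rintro ⟨a, ha, h⟩
      have h0 : x 0 = _ := ha 0
      have h1 : x 1 = _ := h
      refine ⟨⟨⟨_, h0.symm⟩, ⟨_, h1.symm⟩⟩, ?_⟩
      rw [h0, h1, frame_zero, addRel_iff]
      erw [Ring.CompatibleRing.funMap_neg a]
      exact add_neg_cancel _
    · rintro ⟨⟨⟨a, h0⟩, ⟨b, h1⟩⟩, h⟩
      rw [← h0, ← h1, frame_zero, addRel_iff] at h
      refine ⟨![a], fun i => ?_, ?_⟩
      · fin_cases i; exact h0.symm
      · exact h1.symm.trans (congrArg _ ((eq_neg_of_add_eq_zero_right h).trans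
          (Ring.CompatibleRing.funMap_neg ![a]).symm))
  | zero =>
    convert Set.DefinableFun.ofPred_eq (.proj _ (i := (0 : Fin 1))) (hcf 0 _) using 1
    ext x
    constructor
    · rintro ⟨a, ha, h⟩
      exact h.trans (congrArg _ (Ring.CompatibleRing.funMap_zero a))
    · intro h
      exact ⟨Fin.elim0, fun i => i.elim0, h.trans (congrArg (diagPt hV T) (Ring.CompatibleRing.funMap_zero _).symm)⟩
  | one =>
    convert Set.DefinableFun.ofPred_eq (.proj _ (i := (0 : Fin 1))) (hcf 3 _) using 1
    ext x
    constructor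
    · rintro ⟨a, ha, h⟩
      exact h.trans (congrArg _ (Ring.CompatibleRing.funMap_one a))
    · intro h
      exact ⟨Fin.elim0, fun i => i.elim0, h.trans (congrArg (diagPt hV T) (Ring.CompatibleRing.funMap_one _).symm)⟩

/-- All definable relations on the field are definable on the diagonal. -/
theorem definable_image_diagPt (hA : ∀ i, frame hV T i ∈ A) {β : Type*} [Finite β]
    {S : Set (β → K)} (hS : (∅ : Set K).Definable Language.ring S) :
    A.Definable Language.order {x : β → V | ∃ a ∈ S, ∀ i, x i = diagPt hV T (a i)} :=
  definable_image_of_definable (diagPt_injective hV T) (definable_range_diagPt hV T hA)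
    (definable_ring_graph hV T hA) (fun _ r => r.elim) hS

/-- The interpretation of the field in the family of curves: its elements are represented by the points
of the diagonal. -/
noncomputable def fieldInterpretation (hA : ∀ i, frame hV T i ∈ A) :
    Interpretation Language.order V A Language.ring K where
  dim := 1
  dom := {x | x 0 ∈ Set.range (diagPt hV T)}
  map x := Function.invFun (diagPt hV T) (x 0)
  surj := fun a _ => ⟨fun _ => diagPt hV T a, ⟨a, rfl⟩,
    Function.leftInverse_invFun (diagPt_injective hV T) a⟩
  definable_dom := definable_range_diagPt hV T hA
  definable_eq := by
    have h := definable_range_diagPt hV T hA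
    convert definable_and (definable_forall_index fun i : Fin 2 =>
      h.preimage_comp fun j : Fin 1 => (i, j)) (Set.DefinableFun.ofPred_eq
        (.proj _ (i := ((0 : Fin 2), (0 : Fin 1)))) (.proj _ (i := ((1 : Fin 2), (0 : Fin 1))))) using 1
    ext x
    refine and_congr_right fun hx => ?_
    obtain ⟨a, ha⟩ := hx 0
    obtain ⟨b, hb⟩ := hx 1
    have e := Function.leftInverse_invFun (diagPt_injective hV T)
    have ha : diagPt hV T a = x (0, 0) := ha
    have hb : diagPt hV T b = x (1, 0) := hb
    simp only
    rw [← ha, ← hb, e, e, (diagPt_injective hV T).eq_iff]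
  definable_fun k g := by
    convert (definable_ring_graph hV T hA k g).preimage_comp fun i => (i, (0 : Fin 1)) using 1
    have e := Function.leftInverse_invFun (diagPt_injective hV T)
    ext x
    constructor
    · rintro ⟨h, h'⟩
      choose a ha using h
      refine ⟨fun i => a i.castSucc, fun i => (ha _).symm, (ha _).symm.trans (congrArg _ ?_)⟩
      simp only [← ha, e _] at h'
      exact h'.symm
    · rintro ⟨a, ha, h⟩
      have ha : ∀ i, x (i.castSucc, 0) = diagPt hV T (a i) := ha
      have h : x (Fin.last k, 0) = diagPt hV T (Structure.funMap g a) := h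
      refine ⟨fun i => ?_, ?_⟩
      · refine Fin.lastCases ⟨_, h.symm⟩ (fun i => ⟨_, (ha i).symm⟩) i
      · simp only [ha, h, e _]
  definable_rel _ r := r.elim

end

/-! ### Bi-interpretability from a coding -/

section
variable {V : Set (Set (Plane K))} (hV : IsPlaneFamily V) (T : (Fin 3 → K) ≃ₗ[K] (Fin 3 → K))
  {A : Set V}

variable {m : ℕ} {dom : Set (Fin m → K)} {E : (Fin m → K) → (Fin 3 → K) → Prop}
  {map : (Fin m → K) → V}

theorem definable_incidence
    (hE : (∅ : Set K).Definable Language.ring {w : Fin m ⊕ Fin 3 → K | E (w ∘ Sum.inl) (w ∘ Sum.inr)})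
    {α : Type*} (s : Fin m → α) :
    (∅ : Set K).Definable Language.ring {w : α ⊕ Fin 3 → K | E (fun j => w (Sum.inl (s j))) (w ∘ Sum.inr)} :=
  hE.preimage_comp (Sum.elim (fun j => Sum.inl (s j)) Sum.inr)

/-- A family of curves whose members are coded, in a definable way, by tuples from the field
is interpretable in the field. -/
noncomputable def familyInterpretation (hdom : (∅ : Set K).Definable Language.ring dom)
    (hE : (∅ : Set K).Definable Language.ring {w : Fin m ⊕ Fin 3 → K | E (w ∘ Sum.inl) (w ∘ Sum.inr)})
    (hmap : ∀ x ∈ dom, ∀ z, E x z ↔ z ≠ 0 ∧ vpt hV T z ≤ map x)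
    (hsurj : Set.SurjOn map dom Set.univ) :
    Interpretation Language.ring K ∅ Language.order V where
  dim := m
  dom := dom
  map := map
  surj := hsurj
  definable_dom := hdom
  definable_eq := by
    convert definable_and (definable_forall_index fun i : Fin 2 =>
      hdom.preimage_comp fun j : Fin m => (i, j)) (definable_forall_tuple (β := Fin 3)
        (p := fun x z => E (fun j => x ((0 : Fin 2), j)) z ↔ E (fun j => x (1, j)) z)
        (definable_iff (definable_incidence hE fun j => (0, j))
          (definable_incidence hE fun j => (1, j)))) using 1
    ext x
    refine and_congr_right fun hx => ?_
    rw [eq_iff_forall_vpt hV T]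
    simp only [hmap _ (hx _)]
  definable_fun _ g := g.elim
  definable_rel k r := by
    cases r
    convert definable_and (definable_forall_index fun i : Fin 2 =>
      hdom.preimage_comp fun j : Fin m => (i, j)) (definable_forall_tuple (β := Fin 3)
        (p := fun x z => E (fun j => x ((0 : Fin 2), j)) z → E (fun j => x (1, j)) z)
        (definable_imp (definable_incidence hE fun j => (0, j))
          (definable_incidence hE fun j => (1, j)))) using 1
    ext x
    refine and_congr_right fun hx => ?_
    have : ∀ y : Fin 2 → V, Structure.RelMap (leSymb : Language.order.Relations 2) y ↔ y 0 ≤ y 1 :=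
      fun y => Iff.rfl
    refine (this _).trans ?_
    rw [le_iff_forall_vpt hV T]
    simp only [hmap _ (hx _)]

/-- A family of curves is bi-interpretable with the field as soon as its members have codes in the field
for which the incidence `E` between codes and homogeneous coordinate vectors of points is definable. A
code is represented inside the family by points of the diagonal, and its value is then definable as the
element which contains exactly the points with coordinates incident to the code. -/
theorem biInterpretable_of_coding (hA : ∀ i, frame hV T i ∈ A)
    (hdom : (∅ : Set K).Definable Language.ring dom)
    (hE : (∅ : Set K).Definable Language.ring {w : Fin m ⊕ Fin 3 → K | E (w ∘ Sum.inl) (w ∘ Sum.inr)})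
    (hmap : ∀ x ∈ dom, ∀ z, E x z ↔ z ≠ 0 ∧ vpt hV T z ≤ map x)
    (hsurj : Set.SurjOn map dom Set.univ) :
    BiInterpretable Language.ring K ∅ Language.order V A := by
  have hinv := Function.leftInverse_invFun (diagPt_injective hV T)
  refine ⟨familyInterpretation hV T hdom hE hmap hsurj, fieldInterpretation hV T hA, ?_, ?_⟩
  · -- The scalar `a` represented by a code of a point of the diagonal is definable, because the vectors
    -- incident to the code are the nonzero multiples of `(1, a, a)`.
    have hmul : ∀ (i : Fin 3), (∅ : Set K).Definable Language.ring
        {w : ((Fin 1 × Fin m) ⊕ Unit) ⊕ Fin 3 → K |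
          w (Sum.inr i) = w (Sum.inl (Sum.inr ())) * w (Sum.inr 0)} := by
      intro i
      exact Set.DefinableFun.ofPred_eq (.proj _) (definableFun_mul (.proj _) (.proj _))
    have h1 := definable_and (hdom.preimage_comp fun j : Fin m => (Sum.inl ((0 : Fin 1), j) : (Fin 1 × Fin m) ⊕ Unit))
      (definable_forall_tuple (β := Fin 3)
        (p := fun x z => E (fun j => x (Sum.inl (0, j))) z ↔
          z 0 ≠ 0 ∧ z 1 = x (Sum.inr ()) * z 0 ∧ z 2 = x (Sum.inr ()) * z 0)
        (definable_iff (definable_incidence hE fun j => Sum.inl (0, j))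
          (definable_and (definable_ne_zero (.proj _)) (definable_and (hmul 1) (hmul 2)))))
    refine Eq.mpr (congrArg (fun s => Set.Definable (α := (Fin 1 × Fin m) ⊕ Unit) ∅ Language.ring s) ?_) h1
    refine Set.ext fun (x : (Fin 1 × Fin m) ⊕ Unit → K) => ?_
    have hD : ∀ a, (fun j => x (Sum.inl (0, j))) ∈ dom → (map (fun j => x (Sum.inl (0, j))) = diagPt hV T a ↔
        ∀ z : Fin 3 → K, E (fun j => x (Sum.inl (0, j))) z ↔ z 0 ≠ 0 ∧ z 1 = a * z 0 ∧ z 2 = a * z 0) := by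
      intro a hx
      rw [eq_iff_forall_vpt hV T]
      refine forall_congr' fun z => ?_
      rw [hmap _ hx]
      refine iff_congr Iff.rfl ?_
      constructor
      · rintro ⟨hz, h⟩
        have h := le_antisymm h (((isPt_iff_forall_le hV.singleton_mem hV.nonempty _).1 ⟨_, rfl⟩ _ h).ge)
        obtain ⟨c, rfl⟩ := (vpt_eq_vpt hV T hz (by simp)).1 h
        have hc : c ≠ 0 := by rintro rfl; simp at hz
        simp [hc, mul_comm]
      · rintro ⟨h0, h1, h2⟩
        have hz : z ≠ 0 := fun h => h0 (by rw [h]; rfl)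
        refine ⟨hz, ((vpt_eq_vpt hV T hz (by simp)).2 ⟨z 0, ?_⟩).le⟩
        ext i; fin_cases i <;> simp [h1, h2, mul_comm]
    constructor
    · rintro ⟨hx, ⟨a, ha⟩, h⟩
      have hx := hx (0 : Fin 1)
      refine ⟨hx, (hD _ hx).1 ?_⟩
      have ha : diagPt hV T a = map (fun j => x (Sum.inl (0, j))) := ha
      have h : Function.invFun (diagPt hV T) (map (fun j => x (Sum.inl (0, j)))) = x (Sum.inr ()) := h
      rw [← ha, hinv] at h
      rw [← ha, h]
    · rintro ⟨hx, h⟩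
      have h := (hD _ hx).2 h
      refine ⟨fun (i : Fin 1) => by rw [Subsingleton.elim i 0]; exact hx, ⟨_, h.symm⟩, ?_⟩
      change Function.invFun (diagPt hV T) (map (fun j => x (Sum.inl (0, j)))) = x (Sum.inr ())
      rw [h, hinv]
  · -- The element `v (Sum.inr ())` has the code written on the diagonal as `v ∘ Sum.inl`.
    have h1 := definable_and
      ((definable_image_diagPt hV T hA hdom).preimage_comp
        fun j => (Sum.inl (j, 0) : (Fin m × Fin 1) ⊕ Unit))
      (definable_forall (p := fun (v : (Fin m × Fin 1) ⊕ Unit → V) p => IsPt p →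
          (p ≤ v (Sum.inr ()) ↔ ∃ ζ : Fin 3 → V, HomCoords (frame hV T) (ζ 0) (ζ 1) (ζ 2) p ∧
            ∃ b ∈ {w : Fin m ⊕ Fin 3 → K | E (w ∘ Sum.inl) (w ∘ Sum.inr)},
              (∀ j, v (Sum.inl (j, 0)) = diagPt hV T (b (Sum.inl j))) ∧
                ∀ i, ζ i = diagPt hV T (b (Sum.inr i))))
        (definable_imp (definable_rel₁ (definable_isPt hV.singleton_mem hV.nonempty) (.proj _))
          (definable_iff (definable_rel₂ definable_le (.proj _) (.proj _))
            (definable_exists_tuple (definable_and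
              ((definable_homCoords hV hA).preimage_comp
                ![Sum.inr 0, Sum.inr 1, Sum.inr 2, Sum.inl (Sum.inr ())])
              (by
                have := (definable_image_diagPt hV T hA hE).preimage_comp (Sum.elim
                  (fun j => Sum.inl (Sum.inl (Sum.inl (j, 0)))) Sum.inr :
                    Fin m ⊕ Fin 3 → (((Fin m × Fin 1) ⊕ Unit) ⊕ Unit) ⊕ Fin 3)
                simpa [Sum.forall] using this))))))
    refine Eq.mpr (congrArg (fun s => Set.Definable (α := (Fin m × Fin 1) ⊕ Unit) A Language.order s) ?_) h1
    refine Set.ext fun (v : (Fin m × Fin 1) ⊕ Unit → V) => ?_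
    have hpt : ∀ a ∈ dom, (∀ j, v (Sum.inl (j, 0)) = diagPt hV T (a j)) → ∀ p : V, IsPt p →
        ((∃ ζ : Fin 3 → V, HomCoords (frame hV T) (ζ 0) (ζ 1) (ζ 2) p ∧
            ∃ b ∈ {w : Fin m ⊕ Fin 3 → K | E (w ∘ Sum.inl) (w ∘ Sum.inr)},
              (∀ j, v (Sum.inl (j, 0)) = diagPt hV T (b (Sum.inl j))) ∧
                ∀ i, ζ i = diagPt hV T (b (Sum.inr i))) ↔ p ≤ map a) := by
      intro a hadom ha p hp
      constructor
      · rintro ⟨ζ, hζ, b, hb, hbv, hbζ⟩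
        rw [hbζ, hbζ, hbζ] at hζ
        have h := homCoords_diagPt hV T (z := b ∘ Sum.inr) hζ
        have hba : b ∘ Sum.inl = a := funext fun j =>
          diagPt_injective hV T ((hbv j).symm.trans (ha j))
        have hb : E (b ∘ Sum.inl) (b ∘ Sum.inr) := hb
        rw [hba, hmap a hadom] at hb
        rw [h.2]
        exact hb.2
      · intro hle
        obtain ⟨z, hz⟩ := exists_homCoords hV T hp
        have h := homCoords_diagPt hV T hz
        refine ⟨fun i => diagPt hV T (z i), hz, Sum.elim a z, ?_, ha, fun i => rfl⟩
        refine (hmap a hadom z).2 ⟨h.1, ?_⟩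
        rw [← h.2]
        exact hle
    have hmem : ∀ a ∈ dom, (∀ j, v (Sum.inl (j, 0)) = diagPt hV T (a j)) →
        (map a = v (Sum.inr ()) ↔ ∀ p : V, IsPt p →
          (p ≤ v (Sum.inr ()) ↔ ∃ ζ : Fin 3 → V, HomCoords (frame hV T) (ζ 0) (ζ 1) (ζ 2) p ∧
            ∃ b ∈ {w : Fin m ⊕ Fin 3 → K | E (w ∘ Sum.inl) (w ∘ Sum.inr)},
              (∀ j, v (Sum.inl (j, 0)) = diagPt hV T (b (Sum.inl j))) ∧
                ∀ i, ζ i = diagPt hV T (b (Sum.inr i)))) := by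
      intro a hadom ha
      constructor
      · intro h p hp
        rw [hpt a hadom ha p hp, h]
      · intro h
        rw [eq_iff_forall_vpt hV T]
        intro z
        rw [h _ ⟨_, rfl⟩, hpt a hadom ha _ ⟨_, rfl⟩]
    constructor
    · rintro ⟨hx, hdomx, hlast⟩
      have hx : ∀ j, v (Sum.inl (j, 0)) ∈ Set.range (diagPt hV T) := hx
      choose a ha using hx
      have hinva : (fun j => Function.invFun (diagPt hV T) (v (Sum.inl (j, 0)))) = a :=
        funext fun j => by rw [← ha, hinv]
      have hdomx : (fun j => Function.invFun (diagPt hV T) (v (Sum.inl (j, 0)))) ∈ dom := hdomx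
      have hlast : map (fun j => Function.invFun (diagPt hV T) (v (Sum.inl (j, 0)))) =
        v (Sum.inr ()) := hlast
      rw [hinva] at hdomx hlast
      exact ⟨⟨a, hdomx, fun j => (ha j).symm⟩, (hmem a hdomx fun j => (ha j).symm).1 hlast⟩
    · rintro ⟨⟨a, hadom, ha⟩, h⟩
      have h := (hmem a hadom ha).2 h
      have hinva : (fun j => Function.invFun (diagPt hV T) (v (Sum.inl (j, 0)))) = a :=
        funext fun j => by
          rw [show v (Sum.inl (j, 0)) = _ from ha j, hinv]
      refine ⟨fun j => ⟨a j, (ha j).symm⟩, ?_, ?_⟩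
      · change (fun j => Function.invFun (diagPt hV T) (v (Sum.inl (j, 0)))) ∈ dom
        rwa [hinva]
      · change map (fun j => Function.invFun (diagPt hV T) (v (Sum.inl (j, 0)))) = v (Sum.inr ())
        rwa [hinva]
end

end

section

open MvPolynomial

variable {K : Type*} [Field K]

/-! ### Codes of curves -/

/-- The polynomial with coefficient vector `c`, in which every variable has degree at most `n`. -/
noncomputable def polyOfCoeffs {n : ℕ} (c : (Fin 3 → Fin (n + 1)) → K) : MvPolynomial (Fin 3) K :=
  ∑ μ, C (c μ) * ∏ i, X i ^ (μ i : ℕ)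

theorem eval_polyOfCoeffs {n : ℕ} (c : (Fin 3 → Fin (n + 1)) → K) (z : Fin 3 → K) :
    eval z (polyOfCoeffs c) = ∑ μ, c μ * (z 0 ^ (μ 0 : ℕ) * z 1 ^ (μ 1 : ℕ) * z 2 ^ (μ 2 : ℕ)) := by
  simp [polyOfCoeffs, Fin.prod_univ_three]

theorem polyOfCoeffs_isHomogeneous {n d : ℕ} {c : (Fin 3 → Fin (n + 1)) → K}
    (h : ∀ μ : {μ : Fin 3 → Fin (n + 1) // ∑ i, (μ i : ℕ) ≠ d}, c μ = 0) :
    (polyOfCoeffs c).IsHomogeneous d := by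
  refine IsHomogeneous.sum _ _ _ fun μ _ => ?_
  by_cases hμ : ∑ i, (μ i : ℕ) = d
  · subst hμ
    exact (IsHomogeneous.prod _ _ _ fun i _ => isHomogeneous_X_pow i _).C_mul _
  · rw [h ⟨μ, hμ⟩, map_zero, zero_mul]
    exact isHomogeneous_zero _ _ _

theorem exists_polyOfCoeffs_eq [Infinite K] {n : ℕ} {f : MvPolynomial (Fin 3) K} (hf : f.totalDegree ≤ n) :
    ∃ c : (Fin 3 → Fin (n + 1)) → K, polyOfCoeffs c = f ∧ ∀ d, f.IsHomogeneous d →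
      ∀ μ : {μ : Fin 3 → Fin (n + 1) // ∑ i, (μ i : ℕ) ≠ d}, c μ = 0 := by
  classical
  let e : (Fin 3 → Fin (n + 1)) ↪ (Fin 3 →₀ ℕ) :=
    ⟨fun μ => Finsupp.equivFunOnFinite.symm fun i => (μ i : ℕ), fun μ ν h => by
      ext i
      exact DFunLike.congr_fun h i⟩
  refine ⟨fun μ => coeff (e μ) f, MvPolynomial.funext fun z => ?_, fun d hd μ => ?_⟩
  · rw [eval_eq' z f, polyOfCoeffs, map_sum]
    have hsub : f.support ⊆ Finset.univ.map e := by
      intro s hs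
      have hdeg : ∀ i, s i ≤ n := fun i =>
        ((Finsupp.le_degree i s).trans (le_totalDegree hs)).trans hf
      refine Finset.mem_map.2 ⟨fun i => ⟨s i, Nat.lt_succ_iff.2 (hdeg i)⟩, Finset.mem_univ _, ?_⟩
      ext i
      rfl
    rw [Finset.sum_subset hsub fun s _ hs => by rw [notMem_support_iff.1 hs, zero_mul],
      Finset.sum_map]
    refine Finset.sum_congr rfl fun μ _ => ?_
    simp only [map_mul, map_prod, map_pow, eval_C, eval_X]
    rfl
  · refine hd.coeff_eq_zero ?_
    rw [Finsupp.degree_eq_sum]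
    exact μ.2

theorem isUnit_iff_eval_eq [Infinite K] {f : MvPolynomial (Fin 3) K} :
    IsUnit f ↔ (∃ z, eval z f ≠ 0) ∧ ∀ z z', eval z f = eval z' f := by
  constructor
  · intro h
    have h0 := (isUnit_iff_totalDegree_of_isReduced.1 h).2
    rw [totalDegree_eq_zero_iff_eq_C] at h0
    refine ⟨⟨0, fun h1 => ?_⟩, fun z z' => by rw [h0, eval_C, eval_C]⟩
    rw [h0, eval_C] at h1
    rw [h0, h1, map_zero] at h
    exact not_isUnit_zero h
  · rintro ⟨⟨z, hz⟩, h⟩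
    have : f = C (eval z f) := MvPolynomial.funext fun w => by rw [eval_C, h w z]
    rw [this]
    exact (isUnit_iff_ne_zero.2 hz).map C

/-- Irreducibility in terms of coefficients, for polynomials of total degree at most `n`: their factors
have total degree at most `n` as well. Identities between polynomials are expressed by evaluation, which
is possible over an infinite field. -/
theorem irreducible_polyOfCoeffs_iff [Infinite K] {n : ℕ} {c : (Fin 3 → Fin (n + 1)) → K}
    (hc : (polyOfCoeffs c).totalDegree ≤ n) :
    Irreducible (polyOfCoeffs c) ↔ ¬ IsUnit (polyOfCoeffs c) ∧
      ∀ a b : (Fin 3 → Fin (n + 1)) → K,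
        (∀ z, eval z (polyOfCoeffs c) = eval z (polyOfCoeffs a) * eval z (polyOfCoeffs b)) →
          IsUnit (polyOfCoeffs a) ∨ IsUnit (polyOfCoeffs b) := by
  rw [irreducible_iff]
  refine and_congr_right fun hu => ⟨fun h a b hab => ?_, fun h a b hab => ?_⟩
  · exact h (MvPolynomial.funext fun z => by rw [map_mul, hab])
  · have h0 : polyOfCoeffs c ≠ 0 := by
      intro h0
      have hz : polyOfCoeffs (0 : (Fin 3 → Fin (n + 1)) → K) = 0 := by simp [polyOfCoeffs]
      have := h 0 0 fun z => by rw [hz, h0, map_zero, mul_zero]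
      rw [hz, or_self] at this
      exact not_isUnit_zero this
    rw [hab] at h0 hc
    have ha0 := left_ne_zero_of_mul h0
    have hb0 := right_ne_zero_of_mul h0
    rw [totalDegree_mul_of_isDomain ha0 hb0] at hc
    obtain ⟨a', rfl, -⟩ := exists_polyOfCoeffs_eq (f := a) (n := n) (by omega)
    obtain ⟨b', rfl, -⟩ := exists_polyOfCoeffs_eq (f := b) (n := n) (by omega)
    exact h a' b' fun z => by rw [hab, map_mul]

theorem le_encard_zeroSet_iff {f : MvPolynomial (Fin 3) K} {d m : ℕ} (hf : f.IsHomogeneous d) :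
    (m : ℕ∞) ≤ (zeroSet f).encard ↔ ∃ v : Fin m × Fin 3 → K,
      (∀ i, (∃ k, v (i, k) ≠ 0) ∧ eval (fun k => v (i, k)) f = 0) ∧
        ∀ ij : {ij : Fin m × Fin m // ij.1 ≠ ij.2},
          ¬ ∃ s, ∀ k, v (ij.1.1, k) = s * v (ij.1.2, k) := by
  rw [le_encard_iff_exists_injective]
  constructor
  · rintro ⟨P, hP, hS⟩
    refine ⟨fun x => (P x.1).rep x.2, fun i => ⟨Function.ne_iff.1 (P i).rep_nonzero, hS i⟩, ?_⟩
    rintro ⟨⟨i, j⟩, hij⟩ ⟨s, hs⟩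
    apply hij
    apply hP
    change P i = P j
    rw [← pt_rep (P i), ← pt_rep (P j), pt_eq_pt (P i).rep_nonzero (P j).rep_nonzero]
    exact ⟨s, funext fun k => (hs k).symm⟩
  · rintro ⟨v, hv, hne⟩
    have h0 : ∀ i, (fun k => v (i, k)) ≠ 0 := fun i => Function.ne_iff.2 (hv i).1
    refine ⟨fun i => pt fun k => v (i, k), fun i j h => ?_, fun i => ?_⟩
    · by_contra hij
      obtain ⟨s, hs⟩ := (pt_eq_pt (h0 i) (h0 j)).1 h
      exact hne ⟨(i, j), hij⟩ ⟨s, fun k => (congrFun hs k).symm⟩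
    · exact (pt_mem_zeroSet hf (h0 i)).2 (hv i).2

theorem image_zeroSet_mem_curveFamily [Infinite K] (T : (Fin 3 → K) ≃ₗ[K] (Fin 3 → K))
    {n m d : ℕ} (hd : d ≤ n) {f : MvPolynomial (Fin 3) K} (hf : f.IsHomogeneous d)
    (hfi : Irreducible f) (hm : (m : ℕ∞) ≤ (zeroSet f).encard) :
    planeMap T '' zeroSet f ∈ curveFamily K n m := by
  refine Or.inr ⟨_, d, hd, linSub_isHomogeneous T.symm.toLinearMap hf, irreducible_linSub T.symm hfi, ?_,
    (zeroSet_linSub_symm T hf).symm⟩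
  rw [zeroSet_linSub_symm T hf, (planeMap_injective T).encard_image]
  exact hm

/-- Every curve of the family is defined by an irreducible form in the coordinates given by `T`. -/
theorem exists_image_zeroSet [Infinite K] (T : (Fin 3 → K) ≃ₗ[K] (Fin 3 → K))
    {n m : ℕ} {Z : Set (Plane K)} (hZ : Z ∈ curveFamily K n m) : (∃ P, Z = {P}) ∨
      ∃ (f : MvPolynomial (Fin 3) K) (d : ℕ), d ≤ n ∧ f.IsHomogeneous d ∧ Irreducible f ∧
        (m : ℕ∞) ≤ (zeroSet f).encard ∧ Z = planeMap T '' zeroSet f := by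
  refine hZ.imp id ?_
  rintro ⟨f, d, hd, hf, hfi, hm, rfl⟩
  have hg := linSub_isHomogeneous T.toLinearMap hf
  have h : zeroSet f = planeMap T '' zeroSet (linSub T.toLinearMap f) := by
    rw [← zeroSet_linSub_symm T hg]
    congr 1
    exact MvPolynomial.funext fun x => by simp
  refine ⟨_, d, hd, hg, irreducible_linSub T hfi, ?_, h⟩
  rw [← (planeMap_injective T).encard_image, ← h]
  exact hm

/-- A code consists of a vector `y` and of the coefficients of a polynomial. If `y ≠ 0` it is a code of
the point with coordinates `y`, otherwise of the curve defined by the polynomial, which has to be an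
irreducible form of degree at most `n` with at least `m` zeros in the plane. -/
def codes (K : Type*) [Field K] (n m : ℕ) : Set (Fin 3 ⊕ (Fin 3 → Fin (n + 1)) → K) :=
  {x | (∃ k, x (Sum.inl k) ≠ 0) ∨ ∃ d : Fin (n + 1),
    (∀ μ : {μ : Fin 3 → Fin (n + 1) // ∑ i, (μ i : ℕ) ≠ d}, x (Sum.inr μ) = 0) ∧
      Irreducible (polyOfCoeffs fun μ => x (Sum.inr μ)) ∧
        (m : ℕ∞) ≤ (zeroSet (polyOfCoeffs fun μ => x (Sum.inr μ))).encard}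

/-- The vector `z` represents a point of the variety with code `x`. -/
def CodeIncidence {n : ℕ} (x : Fin 3 ⊕ (Fin 3 → Fin (n + 1)) → K) (z : Fin 3 → K) : Prop :=
  (∃ k, z k ≠ 0) ∧ (((∃ k, x (Sum.inl k) ≠ 0) ∧ ∃ t, ∀ k, z k = t * x (Sum.inl k)) ∨
    (¬ (∃ k, x (Sum.inl k) ≠ 0) ∧ eval z (polyOfCoeffs fun μ => x (Sum.inr μ)) = 0))

/-- The variety with a given code, in the coordinates given by `T`. Outside `codes K n m` the value is
irrelevant. -/
noncomputable def ofCode {n m : ℕ} (hV : IsPlaneFamily (curveFamily K n m))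
    (T : (Fin 3 → K) ≃ₗ[K] (Fin 3 → K)) (x : Fin 3 ⊕ (Fin 3 → Fin (n + 1)) → K) :
    curveFamily K n m := by
  classical
  exact if h : (¬ ∃ k, x (Sum.inl k) ≠ 0) ∧
      planeMap T '' zeroSet (polyOfCoeffs fun μ => x (Sum.inr μ)) ∈ curveFamily K n m
    then ⟨_, h.2⟩ else vpt hV T fun k => x (Sum.inl k)

theorem codeIncidence_iff [Infinite K] {n m : ℕ} (hV : IsPlaneFamily (curveFamily K n m))
    (T : (Fin 3 → K) ≃ₗ[K] (Fin 3 → K)) {x : Fin 3 ⊕ (Fin 3 → Fin (n + 1)) → K} (hx : x ∈ codes K n m)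
    (z : Fin 3 → K) : CodeIncidence x z ↔ z ≠ 0 ∧ vpt hV T z ≤ ofCode hV T x := by
  have hne : ∀ {y : Fin 3 → K}, (∃ k, y k ≠ 0) ↔ y ≠ 0 := fun {y} => Function.ne_iff.symm
  rw [CodeIncidence, hne]
  refine and_congr_right fun hz => ?_
  by_cases hy : ∃ k, x (Sum.inl k) ≠ 0
  · rw [ofCode, dif_neg (by tauto)]
    simp only [hy, true_and, not_true_eq_false, false_and, or_false]
    have hy' : (fun k => x (Sum.inl k)) ≠ 0 := hne.1 hy
    constructor
    · rintro ⟨t, ht⟩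
      exact ((vpt_eq_vpt hV T hz hy').2 ⟨t, funext fun k => (ht k).symm⟩).le
    · intro h
      have h := le_antisymm h (((isPt_iff_forall_le hV.singleton_mem hV.nonempty _).1 ⟨_, rfl⟩ _ h).ge)
      obtain ⟨t, ht⟩ := (vpt_eq_vpt hV T hz hy').1 h
      exact ⟨t, fun k => (congrFun ht k).symm⟩
  · obtain ⟨d, hd, hi, hm⟩ := hx.resolve_left hy
    have hhom := polyOfCoeffs_isHomogeneous (c := fun μ => x (Sum.inr μ)) hd
    rw [ofCode, dif_pos ⟨hy, image_zeroSet_mem_curveFamily T (Nat.lt_succ_iff.1 d.2) hhom hi hm⟩,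
      vpt_le_iff]
    simp only [hy, false_and, not_false_eq_true, true_and, false_or]
    rw [← planeMap_pt T hz, (planeMap_injective T).mem_set_image, pt_mem_zeroSet hhom hz]

theorem surjOn_ofCode [Infinite K] {n m : ℕ} (hV : IsPlaneFamily (curveFamily K n m))
    (T : (Fin 3 → K) ≃ₗ[K] (Fin 3 → K)) : Set.SurjOn (ofCode hV T) (codes K n m) Set.univ := by
  rintro ⟨Z, hZ⟩ -
  rcases exists_image_zeroSet T hZ with ⟨P, rfl⟩ | ⟨f, d, hd, hf, hfi, hm, rfl⟩
  · obtain ⟨v, hv, hvP⟩ := (isPt_iff hV T (x := ⟨{P}, hZ⟩)).1 ⟨P, rfl⟩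
    have hv' : ∃ k, v k ≠ 0 := Function.ne_iff.1 hv
    refine ⟨Sum.elim v 0, Or.inl hv', ?_⟩
    rw [ofCode, dif_neg (fun h => h.1 hv'), hvP]
    rfl
  · obtain ⟨c, rfl, hc⟩ := exists_polyOfCoeffs_eq (hf.totalDegree_le.trans hd)
    refine ⟨Sum.elim 0 c, Or.inr ⟨⟨d, Nat.lt_succ_iff.2 hd⟩, hc d hf, hfi, hm⟩, ?_⟩
    rw [ofCode, dif_pos ⟨fun ⟨k, hk⟩ => hk rfl, hZ⟩]
    rfl

end

section

open FirstOrder FirstOrder.Language MvPolynomial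

variable {K : Type*} [Field K] [FirstOrder.Ring.CompatibleRing K]

/-! ### Definability of the codes -/

section Definability
variable {α : Type*} {n : ℕ}

theorem definableFun_eval_polyOfCoeffs {c : (Fin 3 → Fin (n + 1)) → (α → K) → K} {z : Fin 3 → (α → K) → K}
    (hc : ∀ μ, (∅ : Set K).DefinableFun Language.ring (c μ))
    (hz : ∀ i, (∅ : Set K).DefinableFun Language.ring (z i)) :
    (∅ : Set K).DefinableFun Language.ring fun x =>
      eval (fun i => z i x) (polyOfCoeffs fun μ => c μ x) := by
  simp only [eval_polyOfCoeffs]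
  exact definableFun_sum _ fun μ _ => definableFun_mul (hc μ) (definableFun_mul
    (definableFun_mul (definableFun_pow (hz 0) _) (definableFun_pow (hz 1) _))
    (definableFun_pow (hz 2) _))

theorem definable_isUnit_polyOfCoeffs [Infinite K] (s : (Fin 3 → Fin (n + 1)) → α) :
    (∅ : Set K).Definable Language.ring {x : α → K | IsUnit (polyOfCoeffs fun μ => x (s μ))} := by
  simp only [isUnit_iff_eval_eq]
  refine definable_and (definable_exists_tuple (p := fun (x : α → K) z =>
    eval z (polyOfCoeffs fun μ => x (s μ)) ≠ 0) (definable_ne_zero ?_))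
    (definable_forall_tuple (p := fun (x : α → K) z => ∀ z', eval z (polyOfCoeffs fun μ => x (s μ)) =
      eval z' (polyOfCoeffs fun μ => x (s μ))) (definable_forall_tuple
        (p := fun (x : α ⊕ Fin 3 → K) z' => eval (x ∘ Sum.inr) (polyOfCoeffs fun μ => x (Sum.inl (s μ))) =
      eval z' (polyOfCoeffs fun μ => x (Sum.inl (s μ)))) (Set.DefinableFun.ofPred_eq ?_ ?_)))
  all_goals exact definableFun_eval_polyOfCoeffs (fun _ => .proj _) fun _ => .proj _

theorem definable_irreducible_polyOfCoeffs [Infinite K] (s : (Fin 3 → Fin (n + 1)) → α) :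
    (∅ : Set K).Definable Language.ring {x : α → K | ¬ IsUnit (polyOfCoeffs fun μ => x (s μ)) ∧
      ∀ a b : (Fin 3 → Fin (n + 1)) → K,
        (∀ z, eval z (polyOfCoeffs fun μ => x (s μ)) =
          eval z (polyOfCoeffs a) * eval z (polyOfCoeffs b)) →
            IsUnit (polyOfCoeffs a) ∨ IsUnit (polyOfCoeffs b)} := by
  refine definable_and (definable_not (definable_isUnit_polyOfCoeffs s)) ?_
  refine definable_forall_tuple (p := fun (x : α → K) a => ∀ b, (∀ z,
    eval z (polyOfCoeffs fun μ => x (s μ)) = eval z (polyOfCoeffs a) * eval z (polyOfCoeffs b)) →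
      IsUnit (polyOfCoeffs a) ∨ IsUnit (polyOfCoeffs b)) ?_
  refine definable_forall_tuple (p := fun (x : α ⊕ (Fin 3 → Fin (n + 1)) → K) b => (∀ z,
    eval z (polyOfCoeffs fun μ => x (Sum.inl (s μ))) =
      eval z (polyOfCoeffs (x ∘ Sum.inr)) * eval z (polyOfCoeffs b)) →
      IsUnit (polyOfCoeffs (x ∘ Sum.inr)) ∨ IsUnit (polyOfCoeffs b)) ?_
  refine definable_imp (definable_forall_tuple
    (p := fun (x : (α ⊕ (Fin 3 → Fin (n + 1))) ⊕ (Fin 3 → Fin (n + 1)) → K) z =>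
    eval z (polyOfCoeffs fun μ => x (Sum.inl (Sum.inl (s μ)))) =
      eval z (polyOfCoeffs fun μ => x (Sum.inl (Sum.inr μ))) *
        eval z (polyOfCoeffs fun μ => x (Sum.inr μ)))
    (Set.DefinableFun.ofPred_eq ?_ (definableFun_mul ?_ ?_)))
    (definable_or (definable_isUnit_polyOfCoeffs _) (definable_isUnit_polyOfCoeffs _))
  all_goals exact definableFun_eval_polyOfCoeffs (fun _ => .proj _) fun _ => .proj _

theorem definable_exists_eq_mul (y z : Fin 3 → α) :
    (∅ : Set K).Definable Language.ring {x : α → K | ∃ t, ∀ k, x (z k) = t * x (y k)} :=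
  definable_exists (p := fun (x : α → K) t => ∀ k, x (z k) = t * x (y k))
    (definable_forall_index fun _ => Set.DefinableFun.ofPred_eq (.proj _)
      (definableFun_mul (.proj _) (.proj _)))

theorem definable_exists_ne_zero (y : Fin 3 → α) :
    (∅ : Set K).Definable Language.ring {x : α → K | ∃ k, x (y k) ≠ 0} :=
  definable_exists_index fun _ => definable_ne_zero (.proj _)

theorem definable_exists_zeros (s : (Fin 3 → Fin (n + 1)) → α) (m : ℕ) :
    (∅ : Set K).Definable Language.ring {x : α → K | ∃ v : Fin m × Fin 3 → K,
      (∀ i, (∃ k, v (i, k) ≠ 0) ∧ eval (fun k => v (i, k)) (polyOfCoeffs fun μ => x (s μ)) = 0) ∧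
        ∀ ij : {ij : Fin m × Fin m // ij.1 ≠ ij.2},
          ¬ ∃ t, ∀ k, v (ij.1.1, k) = t * v (ij.1.2, k)} := by
  refine definable_exists_tuple (p := fun (x : α → K) v =>
      (∀ i, (∃ k, v (i, k) ≠ 0) ∧ eval (fun k => v (i, k)) (polyOfCoeffs fun μ => x (s μ)) = 0) ∧
        ∀ ij : {ij : Fin m × Fin m // ij.1 ≠ ij.2},
          ¬ ∃ t, ∀ k, v (ij.1.1, k) = t * v (ij.1.2, k)) ?_
  exact definable_and (definable_forall_index fun i => definable_and
      (definable_exists_ne_zero fun k => Sum.inr (i, k))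
      (Set.DefinableFun.ofPred_eq
        (definableFun_eval_polyOfCoeffs (fun _ => .proj _) fun _ => .proj _) definableFun_zero))
    (definable_forall_index fun ij => definable_not
      (definable_exists_eq_mul (fun k => Sum.inr (ij.1.2, k)) fun k => Sum.inr (ij.1.1, k)))

end Definability

theorem definable_codes [Infinite K] (n m : ℕ) : (∅ : Set K).Definable Language.ring (codes K n m) := by
  have h := definable_or (definable_exists_ne_zero (K := K) Sum.inl) (definable_exists_index
    fun d : Fin (n + 1) => definable_and (definable_forall_index
      fun μ : {μ : Fin 3 → Fin (n + 1) // ∑ i, (μ i : ℕ) ≠ d} =>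
        Set.DefinableFun.ofPred_eq (.proj _ (i := Sum.inr μ.1)) definableFun_zero)
      (definable_and (definable_irreducible_polyOfCoeffs (K := K) Sum.inr)
        (definable_exists_zeros Sum.inr m)))
  convert h using 1
  refine Set.ext fun x => or_congr Iff.rfl (exists_congr fun d => and_congr_right fun hd => ?_)
  have hhom := polyOfCoeffs_isHomogeneous (c := fun μ => x (Sum.inr μ)) hd
  rw [irreducible_polyOfCoeffs_iff (hhom.totalDegree_le.trans (Nat.lt_succ_iff.1 d.2)),
    le_encard_zeroSet_iff hhom]

theorem definable_codeIncidence (n : ℕ) : (∅ : Set K).Definable Language.ring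
    {w : (Fin 3 ⊕ (Fin 3 → Fin (n + 1))) ⊕ Fin 3 → K | CodeIncidence (w ∘ Sum.inl) (w ∘ Sum.inr)} :=
  definable_and (definable_exists_ne_zero Sum.inr) (definable_or
    (definable_and (definable_exists_ne_zero fun k => Sum.inl (Sum.inl k))
      (definable_exists_eq_mul (fun k => Sum.inl (Sum.inl k)) Sum.inr))
    (definable_and (definable_not (definable_exists_ne_zero fun k => Sum.inl (Sum.inl k)))
      (Set.DefinableFun.ofPred_eq
        (definableFun_eval_polyOfCoeffs (fun _ => .proj _) fun _ => .proj _) definableFun_zero)))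

/-- The frame is given here by the coordinates `T`. -/
theorem biInterpretable_curveFamily [Infinite K] {n m : ℕ} (hn : 0 < n) (hm : 0 < m)
    (T : (Fin 3 → K) ≃ₗ[K] (Fin 3 → K)) {A : Set (curveFamily K n m)}
    (hA : ∀ i, frame (isPlaneFamily_curveFamily hn hm) T i ∈ A) :
    BiInterpretable Language.ring K ∅ Language.order (curveFamily K n m) A := by
  have hV := isPlaneFamily_curveFamily (K := K) hn hm
  let e := Fintype.equivFin (Fin 3 ⊕ (Fin 3 → Fin (n + 1)))
  refine biInterpretable_of_coding hV T (dom := {x | x ∘ e ∈ codes K n m})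
    (E := fun x z => CodeIncidence (x ∘ e) z) (map := fun x => ofCode hV T (x ∘ e)) hA
    ((definable_codes n m).preimage_comp e)
    ((definable_codeIncidence n).preimage_comp (Sum.map e id)) (fun x hx z => codeIncidence_iff hV T hx z) ?_
  intro Z _
  obtain ⟨x, hx, rfl⟩ := surjOn_ofCode hV T (Set.mem_univ Z)
  have h : (x ∘ e.symm) ∘ e = x := by
    rw [Function.comp_assoc, Equiv.symm_comp_self, Function.comp_id]
  refine ⟨x ∘ e.symm, ?_, ?_⟩
  · change (x ∘ e.symm) ∘ e ∈ codes K n m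
    rwa [h]
  · change ofCode hV T ((x ∘ e.symm) ∘ e) = _
    rw [h]

end

section

open FirstOrder FirstOrder.Language

variable {K : Type*} [Field K]

/-! ### Frames and parameters -/

/-- An interpretation remains one when parameters are added. -/
def Interpretation.mono {L : FirstOrder.Language} {M : Type*} [L.Structure M] {A A' : Set M}
    {L' : FirstOrder.Language} {N : Type*} [L'.Structure N] (I : Interpretation L M A L' N)
    (h : A ⊆ A') : Interpretation L M A' L' N where
  dim := I.dim
  dom := I.dom
  map := I.map
  surj := I.surj
  definable_dom := I.definable_dom.mono h
  definable_eq := I.definable_eq.mono h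
  definable_fun k g := (I.definable_fun k g).mono h
  definable_rel k r := (I.definable_rel k r).mono h

theorem BiInterpretable.mono {L : FirstOrder.Language} {M : Type*} [L.Structure M] {A A' : Set M}
    {L' : FirstOrder.Language} {N : Type*} [L'.Structure N] {B B' : Set N}
    (h : BiInterpretable L M A L' N B) (hA : A ⊆ A') (hB : B ⊆ B') :
    BiInterpretable L M A' L' N B' := by
  obtain ⟨I, J, hI, hJ⟩ := h
  exact ⟨I.mono hA, J.mono hB, hI.mono hA, hJ.mono hB⟩

/-- Coordinates in which a given frame becomes the standard one: the first three vectors are rescaled so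
that their sum represents the fourth point. -/
theorem IsFrame.exists_linearEquiv {p : Fin 4 → Plane K} (hp : IsFrame p) :
    ∃ T : (Fin 3 → K) ≃ₗ[K] (Fin 3 → K), ∀ i,
      pt (T (![![1, 0, 0], ![0, 1, 0], ![0, 0, 1], ![1, 1, 1] ] i)) = p i := by
  have hdet : ∀ i j k : Fin 4, Function.Injective ![i, j, k] →
      (Matrix.of ![(p i).rep, (p j).rep, (p k).rep]).det ≠ 0 := by
    intro i j k h hdet
    have hli := Projectivization.independent_iff.1 (hp _ h)
    have he : (Projectivization.rep ∘ (p ∘ ![i, j, k])) = ![(p i).rep, (p j).rep, (p k).rep] := by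
      ext l : 1; fin_cases l <;> rfl
    rw [he] at hli
    have := (Matrix.linearIndependent_rows_iff_isUnit
      (A := Matrix.of ![(p i).rep, (p j).rep, (p k).rep])).1 hli
    rw [Matrix.isUnit_iff_isUnit_det, hdet] at this
    exact not_isUnit_zero this
  obtain ⟨S, hS⟩ := CurvePoset.exists_linearEquiv (hdet 0 1 2 (by decide))
  obtain ⟨a, ha⟩ := S.surjective (p 3).rep
  rw [hS] at ha
  have h012 := hdet 0 1 2 (by decide)
  have h123 := hdet 1 2 3 (by decide)
  have h023 := hdet 0 2 3 (by decide)
  have h013 := hdet 0 1 3 (by decide)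
  rw [← ha] at h123 h023 h013
  rw [Matrix.det_fin_three] at h012 h123 h023 h013
  simp only [Matrix.of_apply, Matrix.cons_val, Pi.add_apply, Pi.smul_apply, smul_eq_mul] at h012 h123 h023 h013
  have h0 : a 0 ≠ 0 := fun h => h123 (by rw [h]; ring)
  have h1 : a 1 ≠ 0 := fun h => h023 (by rw [h]; ring)
  have h2 : a 2 ≠ 0 := fun h => h013 (by rw [h]; ring)
  have hT : (Matrix.of ![a 0 • (p 0).rep, a 1 • (p 1).rep, a 2 • (p 2).rep]).det ≠ 0 := by
    have h := mul_ne_zero (mul_ne_zero (mul_ne_zero h0 h1) h2) h012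
    refine fun h' => h ?_
    rw [Matrix.det_fin_three] at h'
    simp only [Matrix.of_apply, Matrix.cons_val, Pi.smul_apply, smul_eq_mul] at h'
    linear_combination h'
  obtain ⟨T, hT⟩ := CurvePoset.exists_linearEquiv hT
  refine ⟨T, fun i => ?_⟩
  rw [hT]
  fin_cases i
  · simpa using (pt_smul h0 (p 0).rep_nonzero).trans (pt_rep _)
  · simpa using (pt_smul h1 (p 1).rep_nonzero).trans (pt_rep _)
  · simpa using (pt_smul h2 (p 2).rep_nonzero).trans (pt_rep _)
  · simpa [ha] using pt_rep (p 3)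

theorem exists_points_ne (K : Type*) [Field K] : ∃ P Q : Plane K, P ≠ Q := by
  refine ⟨pt ![1, 0, 0], pt ![0, 1, 0], fun h => ?_⟩
  obtain ⟨c, hc⟩ := (pt_eq_pt (by simp) (by simp)).1 h
  simpa using congrFun hc 0

theorem singleton_mem_of_eq {n : ℕ} {V : Set (Set (Plane K))} (hV : V = Var K n ∨ V = ZariskiVar K n)
    (P : Plane K) : {P} ∈ V := by
  rcases hV with rfl | rfl
  · exact Or.inl ⟨P, rfl⟩
  · refine ⟨isIrreducibleClosed_singleton P, fun h => ?_, Or.inl ⟨P, rfl⟩⟩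
    obtain ⟨Q, R, hQR⟩ := exists_points_ne K
    have hQ : Q ∈ ({P} : Set (Plane K)) := h ▸ Set.mem_univ Q
    have hR : R ∈ ({P} : Set (Plane K)) := h ▸ Set.mem_univ R
    exact hQR (hQ.trans hR.symm)

variable [FirstOrder.Ring.CompatibleRing K]

theorem biInterpretable_of_isFrame [Infinite K] {n m : ℕ} (hn : 0 < n) (hm : 0 < m)
    {p : Fin 4 → Plane K} (hp : IsFrame p) :
    BiInterpretable Language.ring K ∅ Language.order (curveFamily K n m)
      {x : curveFamily K n m | ∃ i, (x : Set (Plane K)) = {p i}} := by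
  obtain ⟨T, hT⟩ := hp.exists_linearEquiv
  exact biInterpretable_curveFamily hn hm T fun i => ⟨i, congrArg (fun P : Plane K => ({P} : Set (Plane K))) (hT i)⟩

end

end CurvePoset

theorem mainTheorem8 {K : Type*} [Field K] [FirstOrder.Ring.CompatibleRing K]
    (n : ℕ) (hn : 0 < n) :
    (IsAlgClosed K → CurvePoset.ZariskiVar K n = CurvePoset.Var K n) ∧
    ∀ V : Set (Set (CurvePoset.Plane K)),
      (V = CurvePoset.Var K n ∨
        (V = CurvePoset.ZariskiVar K n ∧ CurvePoset.BoundedFiniteZeroSets K n)) →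
      -- bi-interpretability with parameters
      CurvePoset.BiInterpretable FirstOrder.Language.ring K Set.univ FirstOrder.Language.order V Set.univ ∧
      (Infinite K →
        -- any four points in general position suffice as parameters
        (∀ p : Fin 4 → CurvePoset.Plane K, CurvePoset.IsFrame p →
          CurvePoset.BiInterpretable FirstOrder.Language.ring K ∅ FirstOrder.Language.order V
            {x : V | ∃ i, (x : Set (CurvePoset.Plane K)) = {p i}}) ∧
        -- description of the lines, and their definability without parameters
        (∀ Z ∈ V, CurvePoset.IsLine Z ↔
          ((n : ℕ∞) < Z.encard ∧ ∀ W ∈ V, W ≠ Z → (Z ∩ W).encard ≤ n)) ∧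
        (∅ : Set V).Definable₁ FirstOrder.Language.order
          {x : V | CurvePoset.IsLine (x : Set (CurvePoset.Plane K))}) := by
  refine ⟨fun _ => CurvePoset.zariskiVar_eq_var_of_isAlgClosed n, fun V hV => ?_⟩
  rcases finite_or_infinite K with hK | hK
  · refine ⟨?_, fun h => absurd h (not_infinite_iff_finite.2 hK)⟩
    have hsing := CurvePoset.singleton_mem_of_eq (hV.imp id And.left)
    obtain ⟨P, Q, hPQ⟩ := CurvePoset.exists_points_ne K
    have : Nontrivial V := ⟨⟨_, hsing P⟩, ⟨_, hsing Q⟩, fun h =>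
      hPQ (Set.singleton_eq_singleton_iff.1 (congrArg Subtype.val h))⟩
    exact CurvePoset.biInterpretable_of_finite K V
  · obtain ⟨m, hm, rfl⟩ : ∃ m, 0 < m ∧ V = CurvePoset.curveFamily K n m := by
      rcases hV with rfl | ⟨rfl, N, hN⟩
      · exact ⟨1, one_pos, CurvePoset.var_eq_curveFamily n⟩
      · exact ⟨N + 1, N.succ_pos, CurvePoset.zariskiVar_eq_curveFamily hN⟩
    refine ⟨?_, fun _ => ⟨fun p hp => CurvePoset.biInterpretable_of_isFrame hn hm hp,
      fun Z hZ => CurvePoset.isLine_iff_encard_inter_le hn hZ,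
      (CurvePoset.isPlaneFamily_curveFamily hn hm).definable_isLine⟩⟩
    exact CurvePoset.BiInterpretable.mono
      (CurvePoset.biInterpretable_curveFamily hn hm (LinearEquiv.refl K _)
        (A := Set.univ) fun _ => Set.mem_univ _) (Set.empty_subset _) subset_rfl
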